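/- Let $M$ be a compact smooth $n$-dimensional manifold, possibly with boundary $\partial M$, and let $g(t)$ be a variation of a Riemannian metric $g=g(0)$ on $M$, that is, a family of Riemannian metrics which is $C^k$ jointly in $t$ (near $t=0$) and in the point of $M$, where $2\le k\le\infty$ ($k=\infty$ is a smooth variation). Let $dM$ be the volume element of $g$, $\nabla$ its Levi-Civita connection, and let $\langle\,,\rangle$ denote the inner products which $g$ induces on tensors: in local coordinates $\langle\alpha,\beta\rangle=g^{ij}\alpha_i\beta_j$ for covectors, and $\langle T,S\rangle=\mathrm{tr}(TS^*)=g^{ik}g^{jl}T_{ij}S_{kl}$ for $(0,2)$-tensors. Let $\nabla^2 f=\nabla df$ be the Hessian and $\Delta_g f=\langle\nabla^2f,g\rangle$ the Laplacian of a function $f$, and let $(\mathrm{div}\,T)(v)=\mathrm{tr}\big(w\mapsto(\nabla_wT)(v)\big)$ be the divergence of a $(0,2)$-tensor $T$, with $\nabla_wT$ regarded as a $(1,1)$-tensor by means of $g$. Put $$H=\frac{d}{dt}\Big|_{t=0}g(t),\qquad h=\langle H,g\rangle=\mathrm{tr}\,H,\qquad \Delta'f=\frac{d}{dt}\Big|_{t=0}\Delta_{g(t)}f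 .$$ Then, for all $f,l\in C^\infty(M)$, the derivative $\Delta'f$ exists at every point of $M$, both integrands below are integrable, and $$\int_M l\,\Delta'f\,dM=\int_M l\Big(\tfrac12\langle dh,df\rangle-\langle \mathrm{div}\,H,df\rangle-\langle H,\nabla^2f\rangle\Big)\,dM .$$ -/

import Mathlib

open scoped Manifold ContDiff
open MeasureTheory

set_option maxSynthPendingDepth 3

noncomputable section

namespace RiemVar

/-! ### Linear algebra on one tangent space

Here `g : V →L[ℝ] V →L[ℝ] ℝ` is a scalar product on a finite-dimensional space `V`. It is at the
same time the isomorphism `V → V*`, `u ↦ g(u, ·)`, and `g.inverse` is the inverse isomorphism. -/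

section LinearAlgebra

variable {V W : Type*} [AddCommGroup V] [Module ℝ V] [TopologicalSpace V]
  [IsTopologicalAddGroup V] [ContinuousSMul ℝ V]
  [AddCommGroup W] [Module ℝ W] [TopologicalSpace W]
  [IsTopologicalAddGroup W] [ContinuousSMul ℝ W]

/-- The pullback `(A^* B)(u, v) = B(A u, A v)` of a `(0,2)`-tensor. -/
def pull (A : V →L[ℝ] W) (B : W →L[ℝ] W →L[ℝ] ℝ) : V →L[ℝ] V →L[ℝ] ℝ :=
  (ContinuousLinearMap.precomp ℝ A) ∘L B ∘L A

theorem pull_apply {V W : Type*} [AddCommGroup V] [Module ℝ V] [TopologicalSpace V]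
    [AddCommGroup W] [Module ℝ W] [TopologicalSpace W]
    (A : V →L[ℝ] W) (B : W →L[ℝ] W →L[ℝ] ℝ) (u v : V) :
    pull A B u v = B (A u) (A v) := rfl

/-- The vector `α♯` dual to the covector `α`, that is `g(α♯, v) = α(v)`. -/
def sharp (g : V →L[ℝ] V →L[ℝ] ℝ) (α : V →L[ℝ] ℝ) : V :=
  g.inverse α

/-- The scalar product `⟨α, β⟩ = α(β♯) = g^{ij} α_i β_j` of covectors. -/
def covectorInner (g : V →L[ℝ] V →L[ℝ] ℝ) (α : V → ℝ) (β : V →L[ℝ] ℝ) : ℝ :=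
  α (sharp g β)

/-- The `(1,1)`-tensor associated with the `(0,2)`-tensor `T`, that is `g(T(u), v) = T(u, v)`. -/
def toEndo (g T : V →L[ℝ] V →L[ℝ] ℝ) : V →L[ℝ] V :=
  g.inverse ∘L T

/-- The `g`-adjoint `A*` of an endomorphism `A`, that is `g(A* u, v) = g(u, A v)`. -/
def adjointEndo (g : V →L[ℝ] V →L[ℝ] ℝ) (A : V →L[ℝ] V) : V →L[ℝ] V :=
  g.inverse ∘L (ContinuousLinearMap.precomp ℝ A) ∘L g

/-- The scalar product `⟨T, S⟩ = tr(T S*) = g^{ik} g^{jl} T_{ij} S_{kl}` of `(0,2)`-tensors. -/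
def tensorInner (g T S : V →L[ℝ] V →L[ℝ] ℝ) : ℝ :=
  LinearMap.trace ℝ V (toEndo g T ∘L adjointEndo g (toEndo g S)).toLinearMap

end LinearAlgebra

/-! ### Levi-Civita calculus in a coordinate domain

`G` is a metric and `T` a `(0,2)`-tensor field on a subset `s` of the model space `E` (the range
of the model with corners: a half space for manifolds with boundary), and `F` is a function
on `s`. All derivatives are taken within `s`, that is, they are one-sided at boundary points. -/

section Coordinates

variable {E : Type*} [NormedAddCommGroup E] [NormedSpace ℝ E]

/-- The Christoffel symbols of the first kind:
`(u, v, w) ↦ ½ (∂_u G(v, w) + ∂_v G(u, w) - ∂_w G(u, v))`. -/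
def christoffelFirst (G : E → E →L[ℝ] E →L[ℝ] ℝ) (s : Set E) (y : E) :
    E →L[ℝ] E →L[ℝ] E →L[ℝ] ℝ :=
  let D : E →L[ℝ] E →L[ℝ] E →L[ℝ] ℝ := fderivWithin ℝ G s y
  let D' : E →L[ℝ] E →L[ℝ] E →L[ℝ] ℝ := ContinuousLinearMap.comp
    ((ContinuousLinearMap.flipₗᵢ ℝ E E ℝ).toContinuousLinearEquiv :
      (E →L[ℝ] E →L[ℝ] ℝ) →L[ℝ] (E →L[ℝ] E →L[ℝ] ℝ)) D.flip
  (1 / 2 : ℝ) • (D + D.flip - D')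

theorem christoffelFirst_apply (G : E → E →L[ℝ] E →L[ℝ] ℝ) (s : Set E) (y u v w : E) :
    christoffelFirst G s y u v w = 1 / 2 * (fderivWithin ℝ G s y u v w
      + fderivWithin ℝ G s y v u w - fderivWithin ℝ G s y w u v) := rfl

/-- The Christoffel symbols `Γ(u, v)` of the Levi-Civita connection of `G`. -/
def christoffel (G : E → E →L[ℝ] E →L[ℝ] ℝ) (s : Set E) (y : E) : E →L[ℝ] E →L[ℝ] E :=
  (ContinuousLinearMap.compL ℝ E (E →L[ℝ] ℝ) E (G y).inverse) ∘L christoffelFirst G s y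

theorem christoffel_apply (G : E → E →L[ℝ] E →L[ℝ] ℝ) (s : Set E) (y u v : E) :
    christoffel G s y u v = sharp (G y) (christoffelFirst G s y u v) := rfl

/-- The Hessian `∇dF`. -/
def hessianCoord (G : E → E →L[ℝ] E →L[ℝ] ℝ) (F : E → ℝ) (s : Set E) (y : E) :
    E →L[ℝ] E →L[ℝ] ℝ :=
  fderivWithin ℝ (fderivWithin ℝ F s) s y
    - (ContinuousLinearMap.compL ℝ E E ℝ (fderivWithin ℝ F s y)) ∘L christoffel G s y

theorem hessianCoord_apply (G : E → E →L[ℝ] E →L[ℝ] ℝ) (F : E → ℝ) (s : Set E) (y u v : E) :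
    hessianCoord G F s y u v = fderivWithin ℝ (fderivWithin ℝ F s) s y u v
      - fderivWithin ℝ F s y (christoffel G s y u v) := rfl

/-- The tensor `(w, z) ↦ (∇_w T)(v, z)`, for a fixed vector `v`. -/
def covDerivCoord (G T : E → E →L[ℝ] E →L[ℝ] ℝ) (s : Set E) (y v : E) :
    E →L[ℝ] E →L[ℝ] ℝ :=
  (fderivWithin ℝ T s y).flip v - T y ∘L (christoffel G s y).flip v
    - (ContinuousLinearMap.compL ℝ E E ℝ (T y v)) ∘L christoffel G s y

theorem covDerivCoord_apply (G T : E → E →L[ℝ] E →L[ℝ] ℝ) (s : Set E) (y v w z : E) :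
    covDerivCoord G T s y v w z = fderivWithin ℝ T s y w v z
      - T y (christoffel G s y w v) z - T y v (christoffel G s y w z) := rfl

/-- The divergence `(div T)(v) = tr(w ↦ (∇_w T)(v))`, where `∇_w T` is seen as
a `(1,1)`-tensor by means of `G`. -/
def divergenceCoord (G T : E → E →L[ℝ] E →L[ℝ] ℝ) (s : Set E) (y v : E) : ℝ :=
  LinearMap.trace ℝ E (toEndo (G y) (covDerivCoord G T s y v)).toLinearMap

end Coordinates

/-! ### Riemannian geometry on a manifold (with or without boundary) -/

section Manifold

variable {n : ℕ} {H : Type*} [TopologicalSpace H]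
  (I : ModelWithCorners ℝ (EuclideanSpace ℝ (Fin n)) H)
  {M : Type*} [TopologicalSpace M] [ChartedSpace H M]

/-- A field of `(0,2)`-tensors on `M`. -/
abbrev TensorField (M : Type*) [TopologicalSpace M] [ChartedSpace H M] : Type _ :=
  (p : M) → TangentSpace I p →L[ℝ] TangentSpace I p →L[ℝ] ℝ

variable {I}

/-- The expression of the tensor field `T` in the chart at `c`: its value at `y` on `e_i, e_j` is
`T(∂_i, ∂_j)` at the point of `M` with coordinates `y`. -/
def coordTensor (T : TensorField I M) (c : M) (y : EuclideanSpace ℝ (Fin n)) :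
    EuclideanSpace ℝ (Fin n) →L[ℝ] EuclideanSpace ℝ (Fin n) →L[ℝ] ℝ :=
  pull (V := EuclideanSpace ℝ (Fin n))
    (mfderivWithin 𝓘(ℝ, EuclideanSpace ℝ (Fin n)) I (extChartAt I c).symm (Set.range I) y)
    (T ((extChartAt I c).symm y))

/-- The differential of the chart at `p` at the point `p`. -/
def chartDifferential (I : ModelWithCorners ℝ (EuclideanSpace ℝ (Fin n)) H) {M : Type*}
    [TopologicalSpace M] [ChartedSpace H M] (p : M) :
    TangentSpace I p →L[ℝ] EuclideanSpace ℝ (Fin n) :=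
  mfderiv I 𝓘(ℝ, EuclideanSpace ℝ (Fin n)) (extChartAt I p) p

/-- The differential `df` of a function. -/
def differential (I : ModelWithCorners ℝ (EuclideanSpace ℝ (Fin n)) H) {M : Type*}
    [TopologicalSpace M] [ChartedSpace H M] (f : M → ℝ) (p : M) : TangentSpace I p →L[ℝ] ℝ :=
  mfderiv I 𝓘(ℝ, ℝ) f p

/-- The Hessian `∇²f = ∇df` with respect to the metric `g`, computed in the chart at `p`. -/
def hessian (g : TensorField I M) (f : M → ℝ) : TensorField I M := fun p ↦
  pull (chartDifferential I p)
    (hessianCoord (coordTensor g p) (f ∘ (extChartAt I p).symm) (Set.range I) (extChartAt I p p))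

/-- The divergence `div T` with respect to the metric `g`, computed in the chart at `p`. -/
def divergence (g T : TensorField I M) (p : M) (v : TangentSpace I p) : ℝ :=
  divergenceCoord (coordTensor g p) (coordTensor T p) (Set.range I) (extChartAt I p p)
    (chartDifferential I p v)

/-- The Laplacian `Δ_g f = ⟨∇²f, g⟩`. -/
def laplacian (g : TensorField I M) (f : M → ℝ) (p : M) : ℝ :=
  tensorInner (g p) (hessian g f p) (g p)

/-- The `g`-trace `⟨T, g⟩` of a tensor field. -/
def traceField (g T : TensorField I M) (p : M) : ℝ :=
  tensorInner (g p) (T p) (g p)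

/-- The Riemannian volume in the chart at `c`: the measure `√(det g_{ij}) dy` of the coordinate
domain, transported to `M`. -/
def chartVolume [MeasurableSpace M] (g : TensorField I M) (c : M) : Measure M :=
  Measure.map (extChartAt I c).symm
    ((volume.restrict (extChartAt I c).target).withDensity fun y ↦
      ENNReal.ofReal (Real.sqrt (Matrix.of fun i j : Fin n ↦ coordTensor g c y
        (EuclideanSpace.single i 1) (EuclideanSpace.single j 1)).det))

/-- A smooth partition of unity subordinate to the charts. -/
def chartPartition (I : ModelWithCorners ℝ (EuclideanSpace ℝ (Fin n)) H) (M : Type*)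
    [TopologicalSpace M] [ChartedSpace H M] [IsManifold I ∞ M] [T2Space M] [CompactSpace M] :
    SmoothPartitionOfUnity M I M Set.univ :=
  (SmoothPartitionOfUnity.exists_isSubordinate_chartAt_source I M).choose

/-- The Riemannian volume measure `dM` of `g`: the volumes in the charts, glued with a partition of
unity. As the volumes of two charts agree where both charts are defined, the partition does not
matter. -/
def volumeMeasure [IsManifold I ∞ M] [T2Space M] [CompactSpace M] [MeasurableSpace M]
    (g : TensorField I M) : Measure M :=
  Measure.sum fun c : M ↦
    (chartVolume g c).withDensity fun p ↦ ENNReal.ofReal (chartPartition I M c p)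

/-! ### Variations of a metric -/

variable [IsManifold I ∞ M]

/-- A Riemannian metric of class `C^k` on `M`. -/
abbrev Metric (I : ModelWithCorners ℝ (EuclideanSpace ℝ (Fin n)) H) (k : ℕ∞ω) (M : Type*)
    [TopologicalSpace M] [ChartedSpace H M] [IsManifold I ∞ M] : Type _ :=
  Bundle.ContMDiffRiemannianMetric I k (EuclideanSpace ℝ (Fin n)) (fun p : M ↦ TangentSpace I p)

/-- The family `g(t)` of metrics is of class `C^k` jointly in `t`, near `t = 0`, and in the point
of `M`. -/
def IsVariation {k : ℕ∞ω} (g : ℝ → Metric I k M) : Prop :=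
  ∃ ε > 0, ContMDiffOn (𝓘(ℝ, ℝ).prod I)
    (I.prod 𝓘(ℝ, EuclideanSpace ℝ (Fin n) →L[ℝ] EuclideanSpace ℝ (Fin n) →L[ℝ] ℝ)) k
    (fun q : ℝ × M ↦ Bundle.TotalSpace.mk'
      (EuclideanSpace ℝ (Fin n) →L[ℝ] EuclideanSpace ℝ (Fin n) →L[ℝ] ℝ)
      (E := fun p : M ↦ TangentSpace I p →L[ℝ] TangentSpace I p →L[ℝ] ℝ)
      q.2 ((g q.1).inner q.2))
    (Set.Ioo (-ε) ε ×ˢ Set.univ)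

/-- The tensor field `H = d/dt|_{t=0} g(t)`. -/
def variationTensor {k : ℕ∞ω} (g : ℝ → Metric I k M) : TensorField I M := fun p ↦
  deriv (fun t ↦ (g t).inner p) 0

/-- `Δ'f = d/dt|_{t=0} Δ_{g(t)} f`. -/
def laplacianVariation {k : ℕ∞ω} (g : ℝ → Metric I k M) (f : M → ℝ) (p : M) : ℝ :=
  deriv (fun t ↦ laplacian (g t).inner f p) 0

end Manifold

end RiemVar

end

/-!
# The first variation of the Laplacian

The two integrands agree at every point, so no integration by parts is involved:
`Δ'f = ½⟨dh, df⟩ - ⟨div H, df⟩ - ⟨H, ∇²f⟩`.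

In a chart, `Δ_{g(t)} f = tr_{g(t)} (D²f - df ∘ Γ(t))`. Its derivative has two parts. The
derivative of the inverse metric gives `-⟨H, ∇²f⟩`. The derivative of the Christoffel symbols
gives `-tr_g W`, where, with `X` the gradient of `f`,
`W(u, v) = ½ ((∇_u H)(v, X) + (∇_v H)(u, X) - (∇_X H)(u, v))`;
here the derivative in `t` has to be exchanged with the derivatives in the
coordinates (`hasDerivAt_fderivWithin_param`), for which the joint `C²` regularity is used. The
first two terms of `W` have the same trace `(div H)(X)`, by the symmetry of `g` and `H`, and the
trace of `∇_X H` is `dh(X)`, since the connection is metric (`fderivWithin_metricTrace`).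
Altogether this is `hasDerivAt_laplacianCoord`, and `laplacianVariation_eq` on the manifold. All
derivatives are taken within the range of the model with corners, which has unique derivatives
and is the closure of its interior, so that boundary points need no separate treatment.

Integrability holds because `Δ'f` is continuous (`continuous_laplacianVariation`) and the volume
is finite (`isFiniteMeasure_volumeMeasure`). As the Laplacian at `p` is defined in the preferred
chart at `p`, which varies with `p` in an arbitrary way, continuity relies on the invariance of
the Laplacian under changes of coordinates (`laplacianCoord_pull`), that is, on the
transformation law of the Christoffel symbols.
-/

namespace RiemVar

open Set Filter Topology

/-! ### Traces with respect to a scalar product -/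

section Trace

variable {E : Type*} [NormedAddCommGroup E] [NormedSpace ℝ E]

theorem inverse_apply_apply {V W : Type*} [AddCommGroup V] [Module ℝ V] [TopologicalSpace V]
    [AddCommGroup W] [Module ℝ W] [TopologicalSpace W] {A : V →L[ℝ] W}
    (hA : A.IsInvertible) (v : V) : A.inverse (A v) = v := by
  obtain ⟨e, rfl⟩ := hA
  simp

theorem apply_inverse_apply {V W : Type*} [AddCommGroup V] [Module ℝ V] [TopologicalSpace V]
    [AddCommGroup W] [Module ℝ W] [TopologicalSpace W] {A : V →L[ℝ] W}
    (hA : A.IsInvertible) (w : W) : A (A.inverse w) = w := by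
  obtain ⟨e, rfl⟩ := hA
  simp

/-- The trace `tr_g T = g^{ij} T_{ij}` of a bilinear form with respect to a scalar product. -/
noncomputable def metricTrace (g T : E →L[ℝ] E →L[ℝ] ℝ) : ℝ :=
  LinearMap.trace ℝ E (toEndo g T).toLinearMap

theorem toEndo_apply (g T : E →L[ℝ] E →L[ℝ] ℝ) (u : E) : toEndo g T u = g.inverse (T u) := rfl

theorem apply_inverse_of_symm {g : E →L[ℝ] E →L[ℝ] ℝ} (hg : g.IsInvertible)
    (hs : ∀ u v, g u v = g v u) (u : E) (α : E →L[ℝ] ℝ) : g u (g.inverse α) = α u := by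
  rw [hs, apply_inverse_apply hg]

theorem apply_inverse_comm {g : E →L[ℝ] E →L[ℝ] ℝ} (hg : g.IsInvertible)
    (hs : ∀ u v, g u v = g v u) (α β : E →L[ℝ] ℝ) : α (g.inverse β) = β (g.inverse α) := by
  rw [← apply_inverse_of_symm hg hs _ α, hs, apply_inverse_of_symm hg hs]

theorem tensorInner_self_right {g : E →L[ℝ] E →L[ℝ] ℝ} (hg : g.IsInvertible)
    (T : E →L[ℝ] E →L[ℝ] ℝ) : tensorInner g T g = metricTrace g T := by
  have : toEndo g T ∘L adjointEndo g (toEndo g g) = toEndo g T := by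
    ext u
    have : (ContinuousLinearMap.precomp ℝ (toEndo g g)) (g u) = g u := by
      ext v
      simp [toEndo_apply, inverse_apply_apply hg]
    simp only [adjointEndo, ContinuousLinearMap.comp_apply]
    rw [this, inverse_apply_apply hg]
  rw [tensorInner, this, metricTrace]

/-- The adjoint of the endomorphism that represents `S` represents the transposed form. -/
theorem adjointEndo_toEndo {g : E →L[ℝ] E →L[ℝ] ℝ} (hg : g.IsInvertible)
    (hs : ∀ u v, g u v = g v u) (S : E →L[ℝ] E →L[ℝ] ℝ) :
    adjointEndo g (toEndo g S) = toEndo g S.flip := by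
  ext u
  have : (ContinuousLinearMap.precomp ℝ (toEndo g S)) (g u) = S.flip u := by
    ext v
    simp [toEndo_apply, apply_inverse_of_symm hg hs]
  simp only [adjointEndo, ContinuousLinearMap.comp_apply]
  rw [this, toEndo_apply]

theorem tensorInner_of_symm {g : E →L[ℝ] E →L[ℝ] ℝ} (hg : g.IsInvertible)
    (hs : ∀ u v, g u v = g v u) (T : E →L[ℝ] E →L[ℝ] ℝ) {S : E →L[ℝ] E →L[ℝ] ℝ}
    (hS : ∀ u v, S u v = S v u) : tensorInner g T S = metricTrace g (T ∘L toEndo g S) := by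
  have h : S.flip = S := by
    ext u v
    exact hS v u
  rw [tensorInner, adjointEndo_toEndo hg hs, h, metricTrace]
  rfl

/-- A form and its transpose have the same trace, because `g` intertwines the endomorphism of the
transposed form with the dual of the endomorphism of the form. -/
theorem metricTrace_flip [FiniteDimensional ℝ E] {g : E →L[ℝ] E →L[ℝ] ℝ} (hg : g.IsInvertible)
    (hs : ∀ u v, g u v = g v u) (T : E →L[ℝ] E →L[ℝ] ℝ) :
    metricTrace g T.flip = metricTrace g T := by
  have hg' := hg
  obtain ⟨e, he⟩ := hg'
  let e' : E ≃ₗ[ℝ] Module.Dual ℝ E :=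
    e.toLinearEquiv.trans (LinearMap.toContinuousLinearMap (𝕜 := ℝ) (E := E) (F' := ℝ)).symm
  have he' : ∀ u v, e' u v = g u v := fun u v ↦ by rw [← he]; rfl
  have key : e'.conj (toEndo g T.flip).toLinearMap
      = Module.Dual.transpose (R := ℝ) (toEndo g T).toLinearMap := by
    ext α v
    obtain ⟨u, rfl⟩ := e'.surjective α
    simp only [LinearEquiv.conj_apply_apply, LinearEquiv.symm_apply_apply,
      Module.Dual.transpose_apply, LinearMap.comp_apply, ContinuousLinearMap.coe_coe, he',
      toEndo_apply]
    rw [apply_inverse_apply hg, apply_inverse_of_symm hg hs]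
    rfl
  rw [metricTrace, metricTrace, ← LinearMap.trace_transpose' (R := ℝ) (toEndo g T).toLinearMap,
    ← key, LinearMap.trace_conj']

theorem pull_isInvertible {A : E →L[ℝ] E} (hA : A.IsInvertible) {g : E →L[ℝ] E →L[ℝ] ℝ}
    (hg : g.IsInvertible) : (pull A g).IsInvertible := by
  refine ContinuousLinearMap.IsInvertible.comp ?_ (hg.comp hA)
  refine ContinuousLinearMap.IsInvertible.of_inverse
    (g := ContinuousLinearMap.precomp ℝ A.inverse) ?_ ?_ <;> ext α v <;>
    simp [inverse_apply_apply hA, apply_inverse_apply hA]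

/-- Raising an index commutes with an isomorphism `A`: the vector dual to `A^* α` with respect to
`A^* g` is mapped by `A` to the vector dual to `α` with respect to `g`. -/
theorem apply_inverse_pull {A : E →L[ℝ] E} (hA : A.IsInvertible) {g : E →L[ℝ] E →L[ℝ] ℝ}
    (hg : g.IsInvertible) (α : E →L[ℝ] ℝ) :
    A ((pull A g).inverse (α ∘L A)) = g.inverse α := by
  have : α ∘L A = pull A g (A.inverse (g.inverse α)) := by
    ext v
    simp [pull_apply, apply_inverse_apply hA, apply_inverse_apply hg]
  rw [this, inverse_apply_apply (pull_isInvertible hA hg), apply_inverse_apply hA]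

theorem metricTrace_pull [FiniteDimensional ℝ E] {A : E →L[ℝ] E} (hA : A.IsInvertible)
    {g : E →L[ℝ] E →L[ℝ] ℝ} (hg : g.IsInvertible) (T : E →L[ℝ] E →L[ℝ] ℝ) :
    metricTrace (pull A g) (pull A T) = metricTrace g T := by
  obtain ⟨e, he⟩ := hA
  have key : e.toLinearEquiv.conj (toEndo (pull A g) (pull A T)).toLinearMap
      = (toEndo g T).toLinearMap := by
    ext v
    obtain ⟨u, rfl⟩ := e.surjective v
    have : pull A T u = (T (A u)) ∘L A := rfl
    have h2 := apply_inverse_pull ⟨e, he⟩ hg (T (A u))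
    rw [← this, ← he] at h2
    rw [← he]
    simpa [LinearEquiv.conj_apply_apply, toEndo_apply] using h2
  rw [metricTrace, metricTrace, ← key, LinearMap.trace_conj']

theorem isInvertible_of_pos [FiniteDimensional ℝ E] {g : E →L[ℝ] E →L[ℝ] ℝ}
    (hg : ∀ v, v ≠ 0 → 0 < g v v) : g.IsInvertible := by
  have hinj : Function.Injective g.toLinearMap := by
    rw [← LinearMap.ker_eq_bot, LinearMap.ker_eq_bot']
    intro v hv
    by_contra h
    have := hg v h
    have h0 : g v = 0 := hv
    simp [h0] at this
  have hdim : Module.finrank ℝ E = Module.finrank ℝ (E →L[ℝ] ℝ) := by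
    rw [← (LinearMap.toContinuousLinearMap (𝕜 := ℝ) (E := E) (F' := ℝ)).finrank_eq]
    exact (Subspace.dual_finrank_eq (K := ℝ) (V := E)).symm
  refine ⟨(LinearEquiv.ofInjectiveOfFinrankEq g.toLinearMap hinj hdim).toContinuousLinearEquiv, ?_⟩
  ext u v
  rfl

end Trace

/-! ### Differentiation of traces and of parametrized derivatives -/

section Derivatives

variable {E : Type*} [NormedAddCommGroup E] [NormedSpace ℝ E]

theorem metricTrace_add (g T S : E →L[ℝ] E →L[ℝ] ℝ) :
    metricTrace g (T + S) = metricTrace g T + metricTrace g S := by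
  simp [metricTrace, toEndo]

theorem metricTrace_sub (g T S : E →L[ℝ] E →L[ℝ] ℝ) :
    metricTrace g (T - S) = metricTrace g T - metricTrace g S := by
  simp [metricTrace, toEndo]

theorem metricTrace_smul (g : E →L[ℝ] E →L[ℝ] ℝ) (c : ℝ) (T : E →L[ℝ] E →L[ℝ] ℝ) :
    metricTrace g (c • T) = c * metricTrace g T := by
  simp [metricTrace, toEndo]

/-- The trace on the space of continuous endomorphisms, as a continuous linear form. -/
noncomputable def traceCLM (E : Type*) [NormedAddCommGroup E] [NormedSpace ℝ E]
    [FiniteDimensional ℝ E] :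
    (E →L[ℝ] E) →L[ℝ] ℝ :=
  (LinearMap.trace ℝ E ∘ₗ ContinuousLinearMap.coeLM ℝ).toContinuousLinearMap

theorem metricTrace_eq [FiniteDimensional ℝ E] (g T : E →L[ℝ] E →L[ℝ] ℝ) :
    metricTrace g T = traceCLM E (g.inverse ∘L T) := rfl

variable {X : Type*} [NormedAddCommGroup X] [NormedSpace ℝ X]

theorem contDiffWithinAt_inverse [FiniteDimensional ℝ E] {F : Type*} [NormedAddCommGroup F]
    [NormedSpace ℝ F] {m : ℕ∞ω} {g : X → E →L[ℝ] F} {S : Set X} {x : X}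
    (hg : ContDiffWithinAt ℝ m g S x) (hi : (g x).IsInvertible) :
    ContDiffWithinAt ℝ m (fun x ↦ (g x).inverse) S x :=
  have := FiniteDimensional.complete ℝ E
  hi.contDiffAt_map_inverse.comp_contDiffWithinAt x hg

theorem contDiffWithinAt_metricTrace [FiniteDimensional ℝ E] {m : ℕ∞ω}
    {g T : X → E →L[ℝ] E →L[ℝ] ℝ} {S : Set X} {x : X} (hg : ContDiffWithinAt ℝ m g S x)
    (hT : ContDiffWithinAt ℝ m T S x) (hi : (g x).IsInvertible) :
    ContDiffWithinAt ℝ m (fun x ↦ metricTrace (g x) (T x)) S x :=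
  (traceCLM E).contDiff.contDiffAt.comp_contDiffWithinAt x
    ((contDiffWithinAt_inverse hg hi).clm_comp hT)

/-- The derivative of the inversion of linear maps at `g` is `A ↦ -g⁻¹ A g⁻¹`. -/
theorem exists_hasFDerivAt_inverse [FiniteDimensional ℝ E] {F : Type*} [NormedAddCommGroup F]
    [NormedSpace ℝ F] {g : E →L[ℝ] F} (hi : g.IsInvertible) :
    ∃ D : (E →L[ℝ] F) →L[ℝ] (F →L[ℝ] E), HasFDerivAt ContinuousLinearMap.inverse D g ∧
      ∀ A, D A = -(g.inverse ∘L A ∘L g.inverse) := by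
  have := FiniteDimensional.complete ℝ E
  have hd : HasFDerivAt ContinuousLinearMap.inverse
      (fderiv ℝ (ContinuousLinearMap.inverse : (E →L[ℝ] F) → _) g) g :=
    ((hi.contDiffAt_map_inverse (n := 1)).differentiableAt one_ne_zero).hasFDerivAt
  refine ⟨_, hd, fun A ↦ ?_⟩
  -- differentiate the identity `f ∘ f⁻¹ = id`
  have hev : (fun f : E →L[ℝ] F ↦ f ∘L f.inverse) =ᶠ[𝓝 g] fun _ ↦ ContinuousLinearMap.id ℝ F := by
    obtain ⟨e, rfl⟩ := hi
    filter_upwards [e.nhds] with f hf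
    ext v
    exact apply_inverse_apply (A := f) hf v
  have h1 := HasFDerivAt.clm_comp (c := fun f : E →L[ℝ] F ↦ f) (hasFDerivAt_id (𝕜 := ℝ) g) hd
  have h2 : HasFDerivAt (fun f : E →L[ℝ] F ↦ f ∘L f.inverse) 0 g :=
    (hasFDerivAt_const (𝕜 := ℝ) (ContinuousLinearMap.id ℝ F) g).congr_of_eventuallyEq hev
  have h3 := DFunLike.congr_fun (h1.unique h2) A
  ext v
  have h4 : g (fderiv ℝ (ContinuousLinearMap.inverse : (E →L[ℝ] F) → _) g A v)
      + A (g.inverse v) = 0 := by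
    simpa using DFunLike.congr_fun h3 v
  have h5 := congrArg g.inverse h4
  rw [map_add, inverse_apply_apply hi, map_zero] at h5
  simpa using eq_neg_of_add_eq_zero_left h5

/-- The derivative of `g⁻¹ α`, where `g` and `α` vary. -/
theorem hasDerivAt_inverse_apply [FiniteDimensional ℝ E] {F : Type*} [NormedAddCommGroup F]
    [NormedSpace ℝ F] {g : ℝ → E →L[ℝ] F} {α : ℝ → F} {g' : E →L[ℝ] F} {α' : F} {t : ℝ}
    (hg : HasDerivAt g g' t) (hα : HasDerivAt α α' t) (hi : (g t).IsInvertible) :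
    HasDerivAt (fun t ↦ (g t).inverse (α t))
      ((g t).inverse (α' - g' ((g t).inverse (α t)))) t := by
  obtain ⟨D, hD, hD'⟩ := exists_hasFDerivAt_inverse hi
  convert! (hD.comp_hasDerivAt t hg).clm_apply hα using 1
  rw [hD']
  simp [sub_eq_neg_add]

/-- The derivative of `tr_g T`, where `g` and `T` vary. -/
theorem exists_hasFDerivWithinAt_metricTrace [FiniteDimensional ℝ E]
    {g T : X → E →L[ℝ] E →L[ℝ] ℝ} {g' T' : X →L[ℝ] E →L[ℝ] E →L[ℝ] ℝ} {S : Set X} {x : X}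
    (hg : HasFDerivWithinAt g g' S x) (hT : HasFDerivWithinAt T T' S x)
    (hi : (g x).IsInvertible) :
    ∃ L : X →L[ℝ] ℝ, HasFDerivWithinAt (fun x ↦ metricTrace (g x) (T x)) L S x ∧
      ∀ v, L v = metricTrace (g x) (T' v - g' v ∘L toEndo (g x) (T x)) := by
  obtain ⟨D, hD, hD'⟩ := exists_hasFDerivAt_inverse hi
  refine ⟨_, (traceCLM E).hasFDerivAt.comp_hasFDerivWithinAt x
    ((hD.comp_hasFDerivWithinAt x hg).clm_comp hT), fun v ↦ ?_⟩
  rw [metricTrace_eq]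
  simp only [ContinuousLinearMap.comp_apply]
  congr 1
  ext u
  simp [hD', toEndo_apply, sub_eq_add_neg]

theorem hasDerivAt_metricTrace [FiniteDimensional ℝ E]
    {g T : ℝ → E →L[ℝ] E →L[ℝ] ℝ} {g' T' : E →L[ℝ] E →L[ℝ] ℝ} {t : ℝ}
    (hg : HasDerivAt g g' t) (hT : HasDerivAt T T' t) (hi : (g t).IsInvertible) :
    HasDerivAt (fun t ↦ metricTrace (g t) (T t))
      (metricTrace (g t) (T' - g' ∘L toEndo (g t) (T t))) t := by
  obtain ⟨L, hL, hL'⟩ := exists_hasFDerivWithinAt_metricTrace hg.hasFDerivAt.hasFDerivWithinAt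
    hT.hasFDerivAt.hasFDerivWithinAt (S := univ) hi
  refine (hasFDerivWithinAt_univ.1 hL).hasDerivAt.congr_deriv ?_
  rw [hL']
  simp

variable {F : Type*} [NormedAddCommGroup F] [NormedSpace ℝ F]

/-- The derivative in the second variable, as a part of the total derivative within `univ ×ˢ s`. -/
theorem fderivWithin_slice_right {Ψ : ℝ × E → F} {s : Set E} {t : ℝ} {y : E}
    (hs : UniqueDiffOn ℝ s) (hys : y ∈ s) (h : DifferentiableWithinAt ℝ Ψ (univ ×ˢ s) (t, y)) :
    fderivWithin ℝ (fun z ↦ Ψ (t, z)) s y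
      = fderivWithin ℝ Ψ (univ ×ˢ s) (t, y) ∘L ContinuousLinearMap.inr ℝ ℝ E := by
  have h1 : HasFDerivWithinAt (fun z : E ↦ (t, z)) (ContinuousLinearMap.inr ℝ ℝ E) s y :=
    (hasFDerivAt_prodMk_right t y).hasFDerivWithinAt
  have h2 : MapsTo (fun z : E ↦ (t, z)) s (univ ×ˢ s) := fun z hz ↦ ⟨mem_univ _, hz⟩
  exact (h.hasFDerivWithinAt.comp y h1 h2).fderivWithin (hs y hys)

/-- The derivative in the first variable, as a part of the total derivative within `univ ×ˢ s`.
It is two-sided in the parameter even where `y` is a boundary point of `s`. -/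
theorem hasDerivAt_slice_left {Ψ : ℝ × E → F} {s : Set E} {t : ℝ} {y : E}
    (hys : y ∈ s) (h : DifferentiableWithinAt ℝ Ψ (univ ×ˢ s) (t, y)) :
    HasDerivAt (fun r ↦ Ψ (r, y)) (fderivWithin ℝ Ψ (univ ×ˢ s) (t, y) (1, 0)) t := by
  have h1 : HasDerivAt (fun r : ℝ ↦ (r, y)) ((1 : ℝ), (0 : E)) t :=
    (hasDerivAt_id t).prodMk (hasDerivAt_const t y)
  have h2 : ∀ᶠ r in 𝓝 t, (r, y) ∈ (univ ×ˢ s : Set (ℝ × E)) :=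
    Eventually.of_forall fun r ↦ ⟨mem_univ _, hys⟩
  exact h.hasFDerivWithinAt.comp_hasDerivAt t h1 h2

omit [NormedSpace ℝ E] in
theorem tendsto_slice_left {s : Set E} {y : E} (hys : y ∈ s) (t : ℝ) :
    Tendsto (fun r : ℝ ↦ (r, y)) (𝓝 t) (𝓝[univ ×ˢ s] (t, y)) := by
  refine tendsto_nhdsWithin_iff.2 ⟨Continuous.tendsto (by fun_prop) t, ?_⟩
  exact Eventually.of_forall fun r ↦ ⟨mem_univ _, hys⟩

omit [NormedSpace ℝ E] in
theorem tendsto_slice_right (s : Set E) (y : E) (t : ℝ) :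
    Tendsto (fun z : E ↦ (t, z)) (𝓝[s] y) (𝓝[univ ×ˢ s] (t, y)) := by
  refine tendsto_nhdsWithin_iff.2
    ⟨(Continuous.tendsto (by fun_prop) y).mono_left nhdsWithin_le_nhds, ?_⟩
  filter_upwards [self_mem_nhdsWithin] with z hz using ⟨mem_univ _, hz⟩

theorem eventually_differentiableWithinAt {Ψ : X → F} {S : Set X} {x : X}
    (h : ContDiffWithinAt ℝ 1 Ψ S x) (hx : x ∈ S) :
    ∀ᶠ q in 𝓝[S] x, DifferentiableWithinAt ℝ Ψ S q := by
  have := h.eventually (by simp)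
  rw [insert_eq_of_mem hx] at this
  filter_upwards [this] with q hq using hq.differentiableWithinAt one_ne_zero

theorem contDiffWithinAt_slice_right {Ψ : ℝ × E → F} {s : Set E} {t : ℝ} {y : E} {m : ℕ∞ω}
    (h : ContDiffWithinAt ℝ m Ψ (univ ×ˢ s) (t, y)) :
    ContDiffWithinAt ℝ m (fun z ↦ Ψ (t, z)) s y :=
  ContDiffWithinAt.comp (g := Ψ) y h (by fun_prop) fun _ hz ↦ ⟨mem_univ _, hz⟩

/-- Near `y`, the derivative in the parameter is a value of the total derivative. -/
theorem deriv_param_eventuallyEq {Φ : ℝ → E → F} {s : Set E} {y : E} (hys : y ∈ s)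
    (hΦ : ContDiffWithinAt ℝ 1 (Function.uncurry Φ) (univ ×ˢ s) (0, y)) :
    (fun z ↦ deriv (fun t ↦ Φ t z) 0) =ᶠ[𝓝[s] y]
      fun z ↦ fderivWithin ℝ (Function.uncurry Φ) (univ ×ˢ s) (0, z) (1, 0) := by
  filter_upwards [(tendsto_slice_right s y 0).eventually
    (eventually_differentiableWithinAt hΦ ⟨mem_univ _, hys⟩),
    self_mem_nhdsWithin] with z hz hzs
  exact (hasDerivAt_slice_left hzs hz).deriv

theorem contDiffWithinAt_deriv_param {Φ : ℝ → E → F} {s : Set E} {y : E} {m k : ℕ∞ω}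
    (hs : UniqueDiffOn ℝ s) (hys : y ∈ s) (hmk : m + 1 ≤ k)
    (hΦ : ContDiffWithinAt ℝ k (Function.uncurry Φ) (univ ×ˢ s) (0, y)) :
    ContDiffWithinAt ℝ m (fun z ↦ deriv (fun t ↦ Φ t z) 0) s y := by
  have h1 := contDiffWithinAt_slice_right
    (hΦ.fderivWithin_right (uniqueDiffOn_univ.prod hs) hmk ⟨mem_univ _, hys⟩)
  exact (h1.clm_apply contDiffWithinAt_const).congr_of_eventuallyEq_of_mem
    (deriv_param_eventuallyEq hys (hΦ.of_le (le_trans le_add_self hmk))) hys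

theorem hasDerivAt_comp_const {A : ℝ → X →L[ℝ] F} {A' : X →L[ℝ] F} {t : ℝ}
    (hA : HasDerivAt A A' t) (B : E →L[ℝ] X) : HasDerivAt (fun t ↦ A t ∘L B) (A' ∘L B) t :=
  (((ContinuousLinearMap.compL ℝ E X F).flip B).hasFDerivAt.comp_hasDerivAt t hA)

/-- The derivative with respect to a parameter commutes with the derivative in the variable: this
is the symmetry of the second derivative within `univ ×ˢ s`, which holds at boundary points of `s`
too, as they are limits of interior points. -/
theorem hasDerivAt_fderivWithin_param {Φ : ℝ → E → F} {s : Set E} {y : E}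
    (hs : UniqueDiffOn ℝ s) (hys : y ∈ s) (hyc : y ∈ closure (interior s))
    (hΦ : ContDiffWithinAt ℝ 2 (Function.uncurry Φ) (univ ×ˢ s) (0, y)) :
    HasDerivAt (fun t ↦ fderivWithin ℝ (Φ t) s y)
      (fderivWithin ℝ (fun z ↦ deriv (fun t ↦ Φ t z) 0) s y) 0 := by
  have hSu : UniqueDiffOn ℝ ((univ : Set ℝ) ×ˢ s) := uniqueDiffOn_univ.prod hs
  have hmem : ((0 : ℝ), y) ∈ (univ : Set ℝ) ×ˢ s := ⟨mem_univ _, hys⟩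
  have hcl : ((0 : ℝ), y) ∈ closure (interior ((univ : Set ℝ) ×ˢ s)) := by
    rw [interior_prod_eq, closure_prod_eq]
    exact ⟨by simp, hyc⟩
  have hsymm : IsSymmSndFDerivWithinAt ℝ (Function.uncurry Φ) (univ ×ˢ s) (0, y) :=
    hΦ.isSymmSndFDerivWithinAt (by simp) hSu hcl hmem
  have hd : DifferentiableWithinAt ℝ (fderivWithin ℝ (Function.uncurry Φ) (univ ×ˢ s))
      (univ ×ˢ s) (0, y) :=
    (hΦ.fderivWithin_right (m := 1) hSu (by norm_num) hmem).differentiableWithinAt one_ne_zero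
  have hev := eventually_differentiableWithinAt (hΦ.of_le one_le_two) hmem
  -- the partial derivatives near `(0, y)` are read off from the total derivative
  have ht : (fun t ↦ fderivWithin ℝ (Φ t) s y) =ᶠ[𝓝 0]
      fun t ↦ fderivWithin ℝ (Function.uncurry Φ) (univ ×ˢ s) (t, y)
        ∘L ContinuousLinearMap.inr ℝ ℝ E := by
    filter_upwards [(tendsto_slice_left hys 0).eventually hev] with t ht
    exact fderivWithin_slice_right hs hys ht
  have hz := deriv_param_eventuallyEq hys (hΦ.of_le one_le_two)
  have hc : DifferentiableWithinAt ℝ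
      (fun q ↦ fderivWithin ℝ (Function.uncurry Φ) (univ ×ˢ s) q (1, 0)) (univ ×ˢ s) (0, y) :=
    hd.clm_apply (differentiableWithinAt_const _)
  have hH := fderivWithin_slice_right hs hys hc
  rw [fderivWithin_clm_apply (hSu _ hmem) hd (differentiableWithinAt_const _)] at hH
  have h1 : HasDerivAt (fun t ↦ fderivWithin ℝ (Function.uncurry Φ) (univ ×ˢ s) (t, y))
      (fderivWithin ℝ (fderivWithin ℝ (Function.uncurry Φ) (univ ×ˢ s)) (univ ×ˢ s) (0, y) (1, 0))
      0 := hasDerivAt_slice_left hys hd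
  have h2 := hasDerivAt_comp_const h1 (ContinuousLinearMap.inr ℝ ℝ E)
  have h3 := h2.congr_of_eventuallyEq ht
  have h4 : fderivWithin ℝ (fun z ↦ deriv (fun t ↦ Φ t z) 0) s y =
      fderivWithin ℝ (fderivWithin ℝ (Function.uncurry Φ) (univ ×ˢ s)) (univ ×ˢ s) (0, y) (1, 0)
        ∘L ContinuousLinearMap.inr ℝ ℝ E := by
    rw [hz.fderivWithin_eq (hz.self_of_nhdsWithin hys), hH]
    ext u
    simpa using hsymm _ _
  rw [h4]
  exact h3

end Derivatives

/-! ### The variation of the Laplacian in a coordinate domain -/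

section CoordinateVariation

variable {E : Type*} [NormedAddCommGroup E] [NormedSpace ℝ E]

/-- The Christoffel symbols of the first kind as a continuous linear function of the
first derivatives of the metric. -/
noncomputable def christoffelCLM (E : Type*) [NormedAddCommGroup E] [NormedSpace ℝ E] :
    (E →L[ℝ] E →L[ℝ] E →L[ℝ] ℝ) →L[ℝ] (E →L[ℝ] E →L[ℝ] E →L[ℝ] ℝ) :=
  let fl : (E →L[ℝ] E →L[ℝ] E →L[ℝ] ℝ) →L[ℝ] (E →L[ℝ] E →L[ℝ] E →L[ℝ] ℝ) :=
    (ContinuousLinearMap.flipₗᵢ ℝ E E (E →L[ℝ] ℝ)).toContinuousLinearEquiv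
  let fl' : (E →L[ℝ] E →L[ℝ] ℝ) →L[ℝ] (E →L[ℝ] E →L[ℝ] ℝ) :=
    (ContinuousLinearMap.flipₗᵢ ℝ E E ℝ).toContinuousLinearEquiv
  (1 / 2 : ℝ) • (ContinuousLinearMap.id ℝ _ + fl
    - ContinuousLinearMap.compL ℝ E (E →L[ℝ] E →L[ℝ] ℝ) (E →L[ℝ] E →L[ℝ] ℝ) fl' ∘L fl)

theorem christoffelFirst_eq (G : E → E →L[ℝ] E →L[ℝ] ℝ) (s : Set E) (y : E) :
    christoffelFirst G s y = christoffelCLM E (fderivWithin ℝ G s y) := rfl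

/-- The Laplacian of `F` with respect to the metric `G`, in coordinates. -/
noncomputable def laplacianCoord (G : E → E →L[ℝ] E →L[ℝ] ℝ) (F : E → ℝ) (s : Set E) (y : E) : ℝ :=
  metricTrace (G y) (hessianCoord G F s y)

variable {s : Set E} {y : E}

theorem fderivWithin_apply_symm {X : Type*} [NormedAddCommGroup X] [NormedSpace ℝ X]
    {S : Set X} {x : X} {T : X → E →L[ℝ] E →L[ℝ] ℝ} (hT : ∀ z u v, T z u v = T z v u)
    (hS : UniqueDiffWithinAt ℝ S x) (w : X) (u v : E) :
    fderivWithin ℝ T S x w u v = fderivWithin ℝ T S x w v u := by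
  let fl := (ContinuousLinearMap.flipₗᵢ ℝ E E ℝ).toContinuousLinearEquiv
  have h1 : fl ∘ T = T := by
    ext z u v
    exact hT z v u
  have h2 := fl.comp_fderivWithin (f := T) hS
  rw [h1] at h2
  have h3 := DFunLike.congr_fun (DFunLike.congr_fun (DFunLike.congr_fun h2 w) u) v
  exact h3

theorem christoffelFirst_symm {G : E → E →L[ℝ] E →L[ℝ] ℝ} (hG : ∀ z u v, G z u v = G z v u)
    (hs : UniqueDiffWithinAt ℝ s y) (u v w : E) :
    christoffelFirst G s y u v w = christoffelFirst G s y v u w := by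
  rw [christoffelFirst_apply, christoffelFirst_apply, fderivWithin_apply_symm hG hs w u v]
  ring

theorem christoffel_symm {G : E → E →L[ℝ] E →L[ℝ] ℝ} (hG : ∀ z u v, G z u v = G z v u)
    (hs : UniqueDiffWithinAt ℝ s y) (u v : E) :
    christoffel G s y u v = christoffel G s y v u := by
  rw [christoffel_apply, christoffel_apply]
  congr 1
  ext w
  exact christoffelFirst_symm hG hs u v w

theorem hessianCoord_symm {G : E → E →L[ℝ] E →L[ℝ] ℝ} (hG : ∀ z u v, G z u v = G z v u)
    {F : E → ℝ} (hs : UniqueDiffOn ℝ s) (hys : y ∈ s) (hyc : y ∈ closure (interior s))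
    (hF : ContDiffWithinAt ℝ 2 F s y) (u v : E) :
    hessianCoord G F s y u v = hessianCoord G F s y v u := by
  rw [hessianCoord_apply, hessianCoord_apply, christoffel_symm hG (hs y hys),
    (hF.isSymmSndFDerivWithinAt (by simp) hs hyc hys) u v]

/-- The Levi-Civita connection is metric: `∂_X G(u, v) = G(Γ(X, u), v) + G(u, Γ(X, v))`. -/
theorem fderivWithin_eq_christoffel {G : E → E →L[ℝ] E →L[ℝ] ℝ}
    (hG : ∀ z u v, G z u v = G z v u) (hi : (G y).IsInvertible)
    (hs : UniqueDiffWithinAt ℝ s y) (x u v : E) :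
    fderivWithin ℝ G s y x u v
      = G y (christoffel G s y x u) v + G y u (christoffel G s y x v) := by
  rw [hG y u, christoffel_apply, christoffel_apply, sharp, sharp, apply_inverse_apply hi,
    apply_inverse_apply hi, christoffelFirst_apply, christoffelFirst_apply,
    fderivWithin_apply_symm hG hs x v u]
  ring

/-- The contribution of the derivative of the metric to the derivative of `tr_G T`, in terms of
Christoffel symbols. -/
theorem metricTrace_fderivWithin_comp_toEndo [FiniteDimensional ℝ E]
    {G : E → E →L[ℝ] E →L[ℝ] ℝ} (hG : ∀ z u v, G z u v = G z v u) (hi : (G y).IsInvertible)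
    (hs : UniqueDiffWithinAt ℝ s y) (x : E) {T : E →L[ℝ] E →L[ℝ] ℝ}
    (hT : ∀ u v, T u v = T v u) :
    metricTrace (G y) (fderivWithin ℝ G s y x ∘L toEndo (G y) T)
      = 2 * metricTrace (G y) (T ∘L christoffel G s y x) := by
  set P := T ∘L christoffel G s y x with hP
  set R := G y ∘L christoffel G s y x ∘L toEndo (G y) T with hR
  have h1 : fderivWithin ℝ G s y x ∘L toEndo (G y) T = R + P.flip := by
    ext u v
    have h2 : G y (toEndo (G y) T u) (christoffel G s y x v) = T u (christoffel G s y x v) := by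
      rw [toEndo_apply, apply_inverse_apply hi]
    simp only [ContinuousLinearMap.comp_apply, add_apply,
      ContinuousLinearMap.flip_apply, hP, hR]
    rw [fderivWithin_eq_christoffel hG hi hs, h2, hT u]
  have h2 : metricTrace (G y) R = metricTrace (G y) P := by
    have e1 : toEndo (G y) R = christoffel G s y x ∘L toEndo (G y) T := by
      ext u
      simp [toEndo_apply, hR, inverse_apply_apply hi]
    have e2 : toEndo (G y) P = toEndo (G y) T ∘L christoffel G s y x := rfl
    rw [metricTrace, metricTrace, e1, e2]
    exact LinearMap.trace_mul_comm ℝ (christoffel G s y x).toLinearMap (toEndo (G y) T).toLinearMap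
  rw [h1, metricTrace_add, metricTrace_flip hi (hG y), h2]
  ring

/-- The derivative of a trace is the trace of the covariant derivative. -/
theorem fderivWithin_metricTrace [FiniteDimensional ℝ E]
    {G T : E → E →L[ℝ] E →L[ℝ] ℝ} (hG : ∀ z u v, G z u v = G z v u)
    (hT : ∀ u v, T y u v = T y v u) (hi : (G y).IsInvertible)
    (hs : UniqueDiffWithinAt ℝ s y) (hGd : DifferentiableWithinAt ℝ G s y)
    (hTd : DifferentiableWithinAt ℝ T s y) (x : E) :
    fderivWithin ℝ (fun z ↦ metricTrace (G z) (T z)) s y x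
      = metricTrace (G y) (fderivWithin ℝ T s y x)
        - 2 * metricTrace (G y) (T y ∘L christoffel G s y x) := by
  obtain ⟨L, hL, hL'⟩ := exists_hasFDerivWithinAt_metricTrace hGd.hasFDerivWithinAt
    hTd.hasFDerivWithinAt hi
  rw [hL.fderivWithin hs, hL', metricTrace_sub, metricTrace_fderivWithin_comp_toEndo hG hi hs x hT]

variable [FiniteDimensional ℝ E] {Φ : ℝ → E → E →L[ℝ] E →L[ℝ] ℝ} {F : E → ℝ}

/-- The variation of the Christoffel symbols. -/
theorem hasDerivAt_christoffel (hs : UniqueDiffOn ℝ s) (hys : y ∈ s)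
    (hyc : y ∈ closure (interior s))
    (hΦ : ContDiffWithinAt ℝ 2 (Function.uncurry Φ) (univ ×ˢ s) (0, y))
    (hi : (Φ 0 y).IsInvertible) (u v : E) :
    HasDerivAt (fun t ↦ christoffel (Φ t) s y u v)
      ((Φ 0 y).inverse (christoffelFirst (fun z ↦ deriv (fun t ↦ Φ t z) 0) s y u v
        - deriv (fun t ↦ Φ t y) 0 (christoffel (Φ 0) s y u v))) 0 := by
  have hΦd : HasDerivAt (fun t ↦ Φ t y) (deriv (fun t ↦ Φ t y) 0) 0 :=
    (hasDerivAt_slice_left hys (hΦ.differentiableWithinAt two_ne_zero)).differentiableAt.hasDerivAt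
  have h1 := (christoffelCLM E).hasFDerivAt.comp_hasDerivAt 0
    (hasDerivAt_fderivWithin_param hs hys hyc hΦ)
  have h2 : HasDerivAt (fun t ↦ christoffelFirst (Φ t) s y u v)
      (christoffelFirst (fun z ↦ deriv (fun t ↦ Φ t z) 0) s y u v) 0 := by
    have h3 := (h1.clm_apply (hasDerivAt_const 0 u)).clm_apply (hasDerivAt_const 0 v)
    simp only [map_zero, add_zero] at h3
    exact h3
  exact hasDerivAt_inverse_apply hΦd h2 hi

/-- The Hessian depends in a `C¹` way on the point and on the parameter of the metric. -/
theorem contDiffWithinAt_hessianCoord (hs : UniqueDiffOn ℝ s) (hys : y ∈ s)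
    (hΦ : ContDiffWithinAt ℝ 2 (Function.uncurry Φ) (univ ×ˢ s) (0, y))
    (hi : (Φ 0 y).IsInvertible) (hF : ContDiffWithinAt ℝ 3 F s y) :
    ContDiffWithinAt ℝ 1 (fun q : ℝ × E ↦ hessianCoord (Φ q.1) F s q.2) (univ ×ˢ s) (0, y) := by
  have hmem : ((0 : ℝ), y) ∈ (univ : Set ℝ) ×ˢ s := ⟨mem_univ _, hys⟩
  have hmaps : MapsTo (Prod.snd : ℝ × E → E) (univ ×ˢ s) s := fun q hq ↦ hq.2
  have hD : ContDiffWithinAt ℝ 1 (fun q : ℝ × E ↦ fderivWithin ℝ (Φ q.1) s q.2)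
      (univ ×ˢ s) (0, y) := by
    refine ContDiffWithinAt.fderivWithin (n := 2) (f := fun q : ℝ × E ↦ Φ q.1) (g := Prod.snd)
      ?_ contDiffWithinAt_snd hs (by norm_num) hmem hmaps
    exact ContDiffWithinAt.comp (g := Function.uncurry Φ)
      (f := fun q : (ℝ × E) × E ↦ (q.1.1, q.2)) ((0, y), y) hΦ (by fun_prop)
      fun q hq ↦ ⟨mem_univ _, hq.2⟩
  have hinv : ContDiffWithinAt ℝ 1 (fun q : ℝ × E ↦ (Φ q.1 q.2).inverse) (univ ×ˢ s) (0, y) :=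
    contDiffWithinAt_inverse (g := Function.uncurry Φ) (hΦ.of_le one_le_two) hi
  have hΓ : ContDiffWithinAt ℝ 1 (fun q : ℝ × E ↦ christoffel (Φ q.1) s q.2)
      (univ ×ˢ s) (0, y) :=
    ((ContinuousLinearMap.compL ℝ E (E →L[ℝ] ℝ) E).contDiff.contDiffAt.comp_contDiffWithinAt _
      hinv).clm_comp ((christoffelCLM E).contDiff.contDiffAt.comp_contDiffWithinAt _ hD)
  have hF1 : ContDiffWithinAt ℝ 2 (fderivWithin ℝ F s) s y :=
    hF.fderivWithin_right hs (by norm_num) hys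
  have hF2 : ContDiffWithinAt ℝ 1 (fderivWithin ℝ (fderivWithin ℝ F s) s) s y :=
    hF1.fderivWithin_right hs (by norm_num) hys
  have hF1' : ContDiffWithinAt ℝ 1 (fun q : ℝ × E ↦ fderivWithin ℝ F s q.2)
      (univ ×ˢ s) (0, y) :=
    ContDiffWithinAt.comp (g := fderivWithin ℝ F s) (0, y) (hF1.of_le one_le_two)
      contDiffWithinAt_snd hmaps
  have hF2' : ContDiffWithinAt ℝ 1 (fun q : ℝ × E ↦ fderivWithin ℝ (fderivWithin ℝ F s) s q.2)
      (univ ×ˢ s) (0, y) :=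
    ContDiffWithinAt.comp (g := fderivWithin ℝ (fderivWithin ℝ F s) s) (0, y) hF2
      contDiffWithinAt_snd hmaps
  exact hF2'.sub (((ContinuousLinearMap.compL ℝ E E ℝ).contDiff.contDiffAt.comp_contDiffWithinAt _
    hF1').clm_comp hΓ)

theorem contDiffWithinAt_laplacianCoord (hs : UniqueDiffOn ℝ s) (hys : y ∈ s)
    (hΦ : ContDiffWithinAt ℝ 2 (Function.uncurry Φ) (univ ×ˢ s) (0, y))
    (hi : (Φ 0 y).IsInvertible) (hF : ContDiffWithinAt ℝ 3 F s y) :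
    ContDiffWithinAt ℝ 1 (fun q : ℝ × E ↦ laplacianCoord (Φ q.1) F s q.2)
      (univ ×ˢ s) (0, y) :=
  contDiffWithinAt_metricTrace (g := Function.uncurry Φ) (hΦ.of_le one_le_two)
    (contDiffWithinAt_hessianCoord hs hys hΦ hi hF) hi

/-- The derivative of the Laplacian with respect to the metric is a continuous function. -/
theorem continuousWithinAt_deriv_laplacianCoord (hs : UniqueDiffOn ℝ s) (hys : y ∈ s)
    (hΦ : ContDiffWithinAt ℝ 2 (Function.uncurry Φ) (univ ×ˢ s) (0, y))
    (hi : (Φ 0 y).IsInvertible) (hF : ContDiffWithinAt ℝ 3 F s y) :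
    ContinuousWithinAt (fun z ↦ deriv (fun t ↦ laplacianCoord (Φ t) F s z) 0) s y := by
  exact (contDiffWithinAt_deriv_param (Φ := fun t z ↦ laplacianCoord (Φ t) F s z) (m := 0) hs hys
    (by norm_num) (contDiffWithinAt_laplacianCoord hs hys hΦ hi hF)).continuousWithinAt

/-- The derivative of the Laplacian with respect to the metric, at a point. The variation of the
Christoffel symbols enters through `H(Γ(u, v), X)` and the first derivatives of `H`, which recombine
into the symmetrized covariant derivative of `H` and `∇_X H`. -/
theorem hasDerivAt_laplacianCoord (hs : UniqueDiffOn ℝ s) (hys : y ∈ s)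
    (hyc : y ∈ closure (interior s))
    (hΦ : ContDiffWithinAt ℝ 2 (Function.uncurry Φ) (univ ×ˢ s) (0, y))
    (hsymm : ∀ t z u v, Φ t z u v = Φ t z v u)
    (hi : (Φ 0 y).IsInvertible) (hF : ContDiffWithinAt ℝ 3 F s y)
    {H : E → E →L[ℝ] E →L[ℝ] ℝ} (hH : H = fun z ↦ deriv (fun t ↦ Φ t z) 0) :
    HasDerivAt (fun t ↦ laplacianCoord (Φ t) F s y)
      (1 / 2 * fderivWithin ℝ (fun z ↦ metricTrace (Φ 0 z) (H z)) s y
          (sharp (Φ 0 y) (fderivWithin ℝ F s y))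
        - divergenceCoord (Φ 0) H s y (sharp (Φ 0 y) (fderivWithin ℝ F s y))
        - metricTrace (Φ 0 y) (H y ∘L toEndo (Φ 0 y) (hessianCoord (Φ 0) F s y))) 0 := by
  have hus := hs y hys
  set X := sharp (Φ 0 y) (fderivWithin ℝ F s y) with hX
  have hHs : ∀ z u v, H z u v = H z v u := by
    intro z u v
    rw [hH]
    simp only [← fderivWithin_univ, ← fderiv_apply_one_eq_deriv]
    exact fderivWithin_apply_symm (fun t ↦ hsymm t z) uniqueDiffWithinAt_univ 1 u v
  have hΦd : HasDerivAt (fun t ↦ Φ t y) (H y) 0 := by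
    rw [hH]
    exact (hasDerivAt_slice_left hys
      (hΦ.differentiableWithinAt two_ne_zero)).differentiableAt.hasDerivAt
  obtain ⟨K', hK'⟩ : ∃ K', HasDerivAt (fun t ↦ hessianCoord (Φ t) F s y) K' 0 :=
    ⟨_, hasDerivAt_slice_left hys
      ((contDiffWithinAt_hessianCoord hs hys hΦ hi hF).differentiableWithinAt one_ne_zero)⟩
  -- the variation of the Hessian
  have hK'apply : ∀ u v, K' u v = -(christoffelFirst H s y u v X
      - H y (christoffel (Φ 0) s y u v) X) := by
    intro u v
    have h1 : HasDerivAt (fun t ↦ hessianCoord (Φ t) F s y u v) (K' u v) 0 := by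
      have := (hK'.clm_apply (hasDerivAt_const 0 u)).clm_apply (hasDerivAt_const 0 v)
      simp only [map_zero, add_zero] at this
      exact this
    have h2 : HasDerivAt (fun t ↦ hessianCoord (Φ t) F s y u v)
        (-(fderivWithin ℝ F s y ((Φ 0 y).inverse (christoffelFirst H s y u v
          - H y (christoffel (Φ 0) s y u v))))) 0 := by
      have h3 := ((fderivWithin ℝ F s y).hasFDerivAt.comp_hasDerivAt 0
        (hasDerivAt_christoffel hs hys hyc hΦ hi u v)).const_sub
          (fderivWithin ℝ (fderivWithin ℝ F s) s y u v)
      rw [← hH, ← congrFun hH y] at h3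
      exact h3
    rw [h1.unique h2, ← sub_apply]
    congr 1
    exact apply_inverse_comm hi (hsymm 0 y) _ _
  -- the variation of the Hessian in terms of covariant derivatives of `H`; the terms `P` are those
  -- by which `∇_X H` differs from the derivative of `H` along `X`
  set Q := toEndo (Φ 0 y) (hessianCoord (Φ 0) F s y) with hQ
  set K := covDerivCoord (Φ 0) H s y X with hK
  set P := H y ∘L christoffel (Φ 0) s y X with hP
  have hK'eq : K' = (1 / 2 : ℝ) • fderivWithin ℝ H s y X
      - (1 / 2 : ℝ) • (K + K.flip + (P + P.flip)) := by
    ext u v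
    simp only [add_apply, sub_apply, smul_apply, smul_eq_mul, ContinuousLinearMap.flip_apply, hK,
      hP, ContinuousLinearMap.comp_apply, covDerivCoord_apply]
    rw [hK'apply, christoffelFirst_apply, fderivWithin_apply_symm hHs hus v u X,
      fderivWithin_apply_symm hHs hus u v X, christoffel_symm (hsymm 0) hus v u,
      hHs y (christoffel (Φ 0) s y u v) X, christoffel_symm (hsymm 0) hus u X,
      christoffel_symm (hsymm 0) hus v X]
    ring
  have hHd : DifferentiableWithinAt ℝ H s y := by
    rw [hH]
    exact (contDiffWithinAt_deriv_param (m := 1) hs hys (by norm_num) hΦ).differentiableWithinAt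
      one_ne_zero
  have hGd : DifferentiableWithinAt ℝ (Φ 0) s y :=
    (contDiffWithinAt_slice_right hΦ).differentiableWithinAt two_ne_zero
  refine (hasDerivAt_metricTrace hΦd hK' hi).congr_deriv ?_
  rw [fderivWithin_metricTrace (hsymm 0) (hHs y) hi hus hGd hHd, metricTrace_sub, hK'eq,
    metricTrace_sub, metricTrace_smul, metricTrace_smul, metricTrace_add, metricTrace_add,
    metricTrace_add, metricTrace_flip hi (hsymm 0 y), metricTrace_flip hi (hsymm 0 y)]
  have : divergenceCoord (Φ 0) H s y X = metricTrace (Φ 0 y) K := rfl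
  rw [this]
  ring

end CoordinateVariation

/-! ### Invariance of the Laplacian under changes of coordinates -/

section CoordinateChange

variable {E : Type*} [NormedAddCommGroup E] [NormedSpace ℝ E]
  {s : Set E} {y : E} {φ : E → E} {G : E → E →L[ℝ] E →L[ℝ] ℝ} {F : E → ℝ}

/-- The derivative of the components of a pulled back `(0,2)`-tensor field. -/
theorem fderivWithin_pull (hs : UniqueDiffOn ℝ s) (hys : y ∈ s)
    (hφ : ContDiffWithinAt ℝ 2 φ s y) (hm : Tendsto φ (𝓝[s] y) (𝓝[s] (φ y)))
    (hG : DifferentiableWithinAt ℝ G s (φ y)) (w u v : E) :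
    fderivWithin ℝ (fun z ↦ pull (fderivWithin ℝ φ s z) (G (φ z))) s y w u v
      = fderivWithin ℝ G s (φ y) (fderivWithin ℝ φ s y w) (fderivWithin ℝ φ s y u)
          (fderivWithin ℝ φ s y v)
        + G (φ y) (fderivWithin ℝ (fderivWithin ℝ φ s) s y w u) (fderivWithin ℝ φ s y v)
        + G (φ y) (fderivWithin ℝ φ s y u) (fderivWithin ℝ (fderivWithin ℝ φ s) s y w v) := by
  have hφ1 := (hφ.differentiableWithinAt two_ne_zero).hasFDerivWithinAt
  have hA := ((hφ.fderivWithin_right (m := 1) hs (by norm_num) hys).differentiableWithinAt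
    one_ne_zero).hasFDerivWithinAt
  have hGφ := HasFDerivWithinAt.comp_of_tendsto y hG.hasFDerivWithinAt hφ1 hm
  have hd : DifferentiableWithinAt ℝ (fun z ↦ pull (fderivWithin ℝ φ s z) (G (φ z))) s y :=
    (((ContinuousLinearMap.compL ℝ E E ℝ).flip.differentiableAt.comp_differentiableWithinAt y
      hA.differentiableWithinAt).clm_comp
        (hGφ.differentiableWithinAt.clm_comp hA.differentiableWithinAt))
  have h1 := (hd.hasFDerivWithinAt.clm_apply (hasFDerivWithinAt_const u y s)).clm_apply
    (hasFDerivWithinAt_const v y s)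
  have h2 := (hGφ.clm_apply (hA.clm_apply (hasFDerivWithinAt_const u y s))).clm_apply
    (hA.clm_apply (hasFDerivWithinAt_const v y s))
  have h3 := DFunLike.congr_fun ((hs y hys).eq h1 h2) w
  simp at h3
  rw [h3]
  ring

theorem christoffelFirst_pull (hs : UniqueDiffOn ℝ s) (hys : y ∈ s) (hyc : y ∈ closure (interior s))
    (hφ : ContDiffWithinAt ℝ 2 φ s y) (hm : Tendsto φ (𝓝[s] y) (𝓝[s] (φ y)))
    (hG : DifferentiableWithinAt ℝ G s (φ y)) (hsymm : ∀ z u v, G z u v = G z v u) (u v w : E) :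
    christoffelFirst (fun z ↦ pull (fderivWithin ℝ φ s z) (G (φ z))) s y u v w
      = christoffelFirst G s (φ y) (fderivWithin ℝ φ s y u) (fderivWithin ℝ φ s y v)
          (fderivWithin ℝ φ s y w)
        + G (φ y) (fderivWithin ℝ (fderivWithin ℝ φ s) s y u v) (fderivWithin ℝ φ s y w) := by
  have hφs := hφ.isSymmSndFDerivWithinAt (by simp) hs hyc hys
  simp only [christoffelFirst_apply, fderivWithin_pull hs hys hφ hm hG]
  rw [hφs v u, hφs w u, hφs w v,
    hsymm _ (fderivWithin ℝ φ s y v) (fderivWithin ℝ (fderivWithin ℝ φ s) s y u w)]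
  ring

/-- The transformation law of the Christoffel symbols. -/
theorem christoffel_pull (hs : UniqueDiffOn ℝ s) (hys : y ∈ s) (hyc : y ∈ closure (interior s))
    (hφ : ContDiffWithinAt ℝ 2 φ s y) (hm : Tendsto φ (𝓝[s] y) (𝓝[s] (φ y)))
    (hG : DifferentiableWithinAt ℝ G s (φ y)) (hsymm : ∀ z u v, G z u v = G z v u)
    (hi : (G (φ y)).IsInvertible) (hA : (fderivWithin ℝ φ s y).IsInvertible) (u v : E) :
    fderivWithin ℝ φ s y (christoffel (fun z ↦ pull (fderivWithin ℝ φ s z) (G (φ z))) s y u v)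
      = christoffel G s (φ y) (fderivWithin ℝ φ s y u) (fderivWithin ℝ φ s y v)
        + fderivWithin ℝ (fderivWithin ℝ φ s) s y u v := by
  have h1 : christoffelFirst (fun z ↦ pull (fderivWithin ℝ φ s z) (G (φ z))) s y u v
      = (christoffelFirst G s (φ y) (fderivWithin ℝ φ s y u) (fderivWithin ℝ φ s y v)
        + G (φ y) (fderivWithin ℝ (fderivWithin ℝ φ s) s y u v)) ∘L fderivWithin ℝ φ s y := by
    ext w
    simpa using christoffelFirst_pull hs hys hyc hφ hm hG hsymm u v w
  rw [christoffel_apply, sharp, h1, apply_inverse_pull hA hi, map_add, inverse_apply_apply hi]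
  rfl

/-- The Hessian is a tensor: the second derivative of the coordinate change in the transformation
law of the Christoffel symbols cancels the one in the second derivative of `F ∘ φ`. -/
theorem hessianCoord_pull (hs : UniqueDiffOn ℝ s) (hys : y ∈ s) (hyc : y ∈ closure (interior s))
    (hφ : ContDiffWithinAt ℝ 2 φ s y) (hm : Tendsto φ (𝓝[s] y) (𝓝[s] (φ y)))
    (hG : DifferentiableWithinAt ℝ G s (φ y)) (hsymm : ∀ z u v, G z u v = G z v u)
    (hi : (G (φ y)).IsInvertible) (hA : (fderivWithin ℝ φ s y).IsInvertible)
    (hφy : φ y ∈ s) (hF : ContDiffWithinAt ℝ 2 F s (φ y)) :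
    hessianCoord (fun z ↦ pull (fderivWithin ℝ φ s z) (G (φ z))) (F ∘ φ) s y
      = pull (fderivWithin ℝ φ s y) (hessianCoord G F s (φ y)) := by
  have hd : HasFDerivWithinAt (fderivWithin ℝ φ s) (fderivWithin ℝ (fderivWithin ℝ φ s) s y) s y :=
    ((hφ.fderivWithin_right (m := 1) hs (by norm_num) hys).differentiableWithinAt
      one_ne_zero).hasFDerivWithinAt
  have hF1 : HasFDerivWithinAt (fderivWithin ℝ F s)
      (fderivWithin ℝ (fderivWithin ℝ F s) s (φ y)) s (φ y) :=
    ((hF.fderivWithin_right (m := 1) hs (by norm_num) hφy).differentiableWithinAt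
      one_ne_zero).hasFDerivWithinAt
  have hev : fderivWithin ℝ (F ∘ φ) s =ᶠ[𝓝[s] y]
      fun z ↦ fderivWithin ℝ F s (φ z) ∘L fderivWithin ℝ φ s z := by
    have hev1 := eventually_differentiableWithinAt (hφ.of_le one_le_two) hys
    have hev2 := hm.eventually
      (eventually_differentiableWithinAt (hF.of_le one_le_two) hφy)
    have hev3 := eventually_eventually_nhdsWithin.2 (hm.eventually eventually_mem_nhdsWithin)
    filter_upwards [hev1, hev2, hev3, eventually_mem_nhdsWithin] with z h1 h2 h3 hz
    refine (HasFDerivWithinAt.comp_of_tendsto z h2.hasFDerivWithinAt h1.hasFDerivWithinAt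
      ?_).fderivWithin (hs z hz)
    exact tendsto_nhdsWithin_iff.2 ⟨h1.continuousWithinAt, h3⟩
  have hφ1 := (hφ.differentiableWithinAt two_ne_zero).hasFDerivWithinAt
  ext u v
  have h1 : fderivWithin ℝ (fderivWithin ℝ (F ∘ φ) s) s y u v
      = fderivWithin ℝ (fderivWithin ℝ F s) s (φ y) (fderivWithin ℝ φ s y u)
          (fderivWithin ℝ φ s y v)
        + fderivWithin ℝ F s (φ y) (fderivWithin ℝ (fderivWithin ℝ φ s) s y u v) := by
    have h2 := (HasFDerivWithinAt.comp_of_tendsto y hF1 hφ1 hm).clm_comp hd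
    have h3 : fderivWithin ℝ (fun z ↦ fderivWithin ℝ F s (φ z) ∘L fderivWithin ℝ φ s z) s y = _ :=
      h2.fderivWithin (hs y hys)
    rw [hev.fderivWithin_eq (hev.self_of_nhdsWithin hys), h3]
    simp [add_comm]
  have h3 := hev.self_of_nhdsWithin hys
  simp only at h3
  rw [pull_apply, hessianCoord_apply, hessianCoord_apply, h1, h3, ContinuousLinearMap.comp_apply,
    christoffel_pull hs hys hyc hφ hm hG hsymm hi hA, map_add]
  ring

theorem laplacianCoord_pull [FiniteDimensional ℝ E] (hs : UniqueDiffOn ℝ s) (hys : y ∈ s)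
    (hyc : y ∈ closure (interior s))
    (hφ : ContDiffWithinAt ℝ 2 φ s y) (hm : Tendsto φ (𝓝[s] y) (𝓝[s] (φ y)))
    (hG : DifferentiableWithinAt ℝ G s (φ y)) (hsymm : ∀ z u v, G z u v = G z v u)
    (hi : (G (φ y)).IsInvertible) (hA : (fderivWithin ℝ φ s y).IsInvertible)
    (hφy : φ y ∈ s) (hF : ContDiffWithinAt ℝ 2 F s (φ y)) :
    laplacianCoord (fun z ↦ pull (fderivWithin ℝ φ s z) (G (φ z))) (F ∘ φ) s y
      = laplacianCoord G F s (φ y) := by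
  rw [laplacianCoord, hessianCoord_pull hs hys hyc hφ hm hG hsymm hi hA hφy hF,
    metricTrace_pull hA hi, laplacianCoord]

/-- The Laplacian depends only on the germs of the metric and of the function. -/
theorem laplacianCoord_congr {G' : E → E →L[ℝ] E →L[ℝ] ℝ} {F' : E → ℝ}
    (hys : y ∈ s) (hG : G =ᶠ[𝓝[s] y] G') (hF : F =ᶠ[𝓝[s] y] F') :
    laplacianCoord G F s y = laplacianCoord G' F' s y := by
  have hGy : G y = G' y := hG.self_of_nhdsWithin hys
  have hFy : F y = F' y := hF.self_of_nhdsWithin hys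
  have h1 := hF.fderivWithin (𝕜 := ℝ)
  have h2 := h1.self_of_nhdsWithin hys
  rw [laplacianCoord, laplacianCoord, hessianCoord, hessianCoord, christoffel, christoffel,
    christoffelFirst_eq, christoffelFirst_eq, hG.fderivWithin_eq hGy, h2,
    h1.fderivWithin_eq h2, hGy]

end CoordinateChange

/-! ### Tensor fields in charts -/

section Charts

variable {n : ℕ} {Hs : Type*} [TopologicalSpace Hs]
  {I : ModelWithCorners ℝ (EuclideanSpace ℝ (Fin n)) Hs}
  {M : Type*} [TopologicalSpace M] [ChartedSpace Hs M]

theorem coordTensor_symm {T : TensorField I M} (hT : ∀ p u v, T p u v = T p v u) (c : M)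
    (y u v : EuclideanSpace ℝ (Fin n)) : coordTensor T c y u v = coordTensor T c y v u :=
  hT _ _ _

variable [IsManifold I ∞ M]

/-- The components of a positive definite tensor field form an invertible map at the points of the
coordinate domain. Outside it, `(extChartAt I c).symm` takes junk values. -/
theorem coordTensor_isInvertible {T : TensorField I M} (hT : ∀ p v, v ≠ 0 → 0 < T p v v) {c : M}
    {y : EuclideanSpace ℝ (Fin n)} (hy : y ∈ (extChartAt I c).target) :
    (coordTensor T c y).IsInvertible := by
  refine isInvertible_of_pos fun v hv ↦ hT _ _ fun h ↦ hv ?_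
  have hB : (mfderivWithin 𝓘(ℝ, EuclideanSpace ℝ (Fin n)) I (extChartAt I c).symm (range I) y
    ).IsInvertible := isInvertible_mfderivWithin_extChartAt_symm hy
  exact (inverse_apply_apply hB v).symm.trans ((congrArg _ h).trans (map_zero _))

/-- The trivialization at `c` of the bundle of `(0,2)`-tensors gives the components in the chart
at `c`. -/
theorem trivializationAt_eq_coordTensor (T : TensorField I M) {c : M}
    {y : EuclideanSpace ℝ (Fin n)} (hy : y ∈ (extChartAt I c).target) :
    (trivializationAt (EuclideanSpace ℝ (Fin n) →L[ℝ] EuclideanSpace ℝ (Fin n) →L[ℝ] ℝ)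
      (fun p : M ↦ TangentSpace I p →L[ℝ] TangentSpace I p →L[ℝ] ℝ) c
      ⟨(extChartAt I c).symm y, T ((extChartAt I c).symm y)⟩).2 = coordTensor T c y := by
  have hp : (extChartAt I c).symm y ∈ (chartAt Hs c).source := by
    rw [← extChartAt_source I]
    exact (extChartAt I c).map_target hy
  have h1 := TangentBundle.symmL_trivializationAt (𝕜 := ℝ) (I := I) hp
  rw [(extChartAt I c).right_inv hy] at h1
  have hb : (extChartAt I c).symm y
      ∈ (trivializationAt (EuclideanSpace ℝ (Fin n)) (TangentSpace I : M → Type _) c).baseSet := by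
    rw [TangentBundle.trivializationAt_baseSet]
    exact hp
  ext u v
  rw [hom_trivializationAt_apply]
  have hu : ∀ u : EuclideanSpace ℝ (Fin n), (trivializationAt (EuclideanSpace ℝ (Fin n))
      (TangentSpace I) c).symm ((extChartAt I c).symm y) u
      = mfderivWithin 𝓘(ℝ, EuclideanSpace ℝ (Fin n)) I (extChartAt I c).symm (range I) y u := by
    intro u
    exact (Bundle.Trivialization.symmL_apply (R := ℝ) _ hb u).symm.trans (DFunLike.congr_fun h1 u)
  refine (inCoordinates_apply_eq₂ hb hb (by simp)).trans ?_
  rw [hu, hu]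
  simp
  rfl

/-- If a family of tensor fields is smooth jointly in the parameter and the point of `M`, so are its
components in a chart. -/
theorem contDiffWithinAt_coordTensor {k : ℕ∞ω} (hk : k ≤ ∞)
    {T : ℝ → TensorField I M} {c p : M} {t : ℝ}
    (hT : ContMDiffAt (𝓘(ℝ, ℝ).prod I)
      (I.prod 𝓘(ℝ, EuclideanSpace ℝ (Fin n) →L[ℝ] EuclideanSpace ℝ (Fin n) →L[ℝ] ℝ)) k
      (fun q : ℝ × M ↦ Bundle.TotalSpace.mk'
        (EuclideanSpace ℝ (Fin n) →L[ℝ] EuclideanSpace ℝ (Fin n) →L[ℝ] ℝ)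
        (E := fun p : M ↦ TangentSpace I p →L[ℝ] TangentSpace I p →L[ℝ] ℝ)
        q.2 (T q.1 q.2)) (t, p))
    (hp : p ∈ (chartAt Hs c).source) :
    ContDiffWithinAt ℝ k (Function.uncurry fun t ↦ coordTensor (T t) c) (univ ×ˢ range I)
      (t, extChartAt I c p) := by
  have hpc : p ∈ (extChartAt I c).source := by rwa [extChartAt_source]
  have hy := (extChartAt I c).map_source hpc
  have : IsManifold I k M := .of_le hk
  have hTM : ContMDiffVectorBundle k (EuclideanSpace ℝ (Fin n)) (TangentSpace I : M → Type _) I :=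
    .of_le hk
  have hR : ContMDiffVectorBundle k ℝ (Bundle.Trivial M ℝ) I := inferInstance
  have hTM' : ContMDiffVectorBundle k (EuclideanSpace ℝ (Fin n) →L[ℝ] ℝ)
      (fun p : M ↦ TangentSpace I p →L[ℝ] ℝ) I :=
    ContMDiffVectorBundle.continuousLinearMap (E₂ := Bundle.Trivial M ℝ)
  have hTM'' : ContMDiffVectorBundle k (EuclideanSpace ℝ (Fin n) →L[ℝ] EuclideanSpace ℝ (Fin n)
      →L[ℝ] ℝ) (fun p : M ↦ TangentSpace I p →L[ℝ] TangentSpace I p →L[ℝ] ℝ) I :=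
    ContMDiffVectorBundle.continuousLinearMap (E₁ := (TangentSpace I : M → Type _))
      (E₂ := fun p : M ↦ TangentSpace I p →L[ℝ] ℝ)
  have h1 := ((Bundle.Trivialization.contMDiffWithinAt_iff (n := k) (s := univ)
    (e := trivializationAt (EuclideanSpace ℝ (Fin n) →L[ℝ] EuclideanSpace ℝ (Fin n) →L[ℝ] ℝ)
      (fun p : M ↦ TangentSpace I p →L[ℝ] TangentSpace I p →L[ℝ] ℝ) c)
    (by simpa [Bundle.Trivialization.mem_source] using hp)).1 hT).2
  have h2 : ContMDiffWithinAt 𝓘(ℝ, ℝ × EuclideanSpace ℝ (Fin n)) (𝓘(ℝ, ℝ).prod I) k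
      (fun q : ℝ × EuclideanSpace ℝ (Fin n) ↦ (q.1, (extChartAt I c).symm q.2))
      (univ ×ˢ range I) (t, extChartAt I c p) := by
    refine ContMDiffWithinAt.prodMk (contDiff_fst.contMDiff _).contMDiffWithinAt ?_
    exact (contMDiffWithinAt_extChartAt_symm_range c hy).comp (t, extChartAt I c p)
      (f := Prod.snd) (contDiff_snd.contMDiff _).contMDiffWithinAt fun q hq ↦ hq.2
  have h3 := ContMDiffWithinAt.comp_of_eq h1 h2 (mapsTo_univ _ _)
    (by rw [(extChartAt I c).left_inv hpc])
  refine h3.contDiffWithinAt.congr_of_eventuallyEq_of_mem ?_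
    ⟨mem_univ _, extChartAt_target_subset_range c hy⟩
  have h4 : ∀ᶠ q in 𝓝[univ ×ˢ range I] (t, extChartAt I c p), q.2 ∈ (extChartAt I c).target := by
    rw [nhdsWithin_prod_eq]
    exact tendsto_snd.eventually (extChartAt_target_mem_nhdsWithin' hpc)
  filter_upwards [h4] with q hq
  exact (trivializationAt_eq_coordTensor (T q.1) hq).symm

omit [IsManifold I ∞ M] in
theorem eventually_extChartAt_symm_mem_source {c p : M} (hp : p ∈ (chartAt Hs c).source) :
    ∀ᶠ z in 𝓝[range I] (extChartAt I p p), (extChartAt I p).symm z ∈ (extChartAt I c).source := by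
  have h1 : Tendsto (extChartAt I p).symm (𝓝[range I] (extChartAt I p p)) (𝓝 p) := by
    have := (continuousAt_extChartAt_symm (I := I) p).tendsto.mono_left
      (nhdsWithin_le_nhds (s := range I))
    rwa [extChartAt_to_inv] at this
  exact h1.eventually ((isOpen_extChartAt_source c).mem_nhds (by rwa [extChartAt_source]))

/-- The components of a tensor field in two charts are related by the transition map. -/
theorem coordTensor_eventuallyEq_pull (T : TensorField I M) {c p : M}
    (hp : p ∈ (chartAt Hs c).source) :
    coordTensor T p =ᶠ[𝓝[range I] (extChartAt I p p)]
      fun z ↦ pull (fderivWithin ℝ (extChartAt I c ∘ (extChartAt I p).symm) (range I) z)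
        (coordTensor T c ((extChartAt I c ∘ (extChartAt I p).symm) z)) := by
  have hsrc := eventually_extChartAt_symm_mem_source (I := I) hp
  filter_upwards [eventually_eventually_nhdsWithin.2 hsrc, hsrc, extChartAt_target_mem_nhdsWithin p]
    with z hz hz' hzt
  have hzr := extChartAt_target_subset_range p hzt
  have hleft : (extChartAt I c).symm ((extChartAt I c ∘ (extChartAt I p).symm) z)
      = (extChartAt I p).symm z := (extChartAt I c).left_inv hz'
  have h2 : (extChartAt I p).symm =ᶠ[𝓝[range I] z]
      (extChartAt I c).symm ∘ (extChartAt I c ∘ (extChartAt I p).symm) := by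
    filter_upwards [hz] with w hw using ((extChartAt I c).left_inv hw).symm
  have h3 : mfderivWithin 𝓘(ℝ, EuclideanSpace ℝ (Fin n)) I (extChartAt I p).symm (range I) z
      = (mfderivWithin 𝓘(ℝ, EuclideanSpace ℝ (Fin n)) I (extChartAt I c).symm (range I)
          ((extChartAt I c ∘ (extChartAt I p).symm) z)) ∘L
        (mfderivWithin 𝓘(ℝ, EuclideanSpace ℝ (Fin n)) 𝓘(ℝ, EuclideanSpace ℝ (Fin n))
          (extChartAt I c ∘ (extChartAt I p).symm) (range I) z) := by
    rw [h2.mfderivWithin_eq hleft.symm]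
    refine mfderivWithin_comp (u := range I) z ?_ ?_ ?_ ?_
    · refine mdifferentiableWithinAt_extChartAt_symm ((extChartAt I c).map_source hz')
    · refine MDifferentiableAt.comp_mdifferentiableWithinAt (I' := I) z
        (mdifferentiableAt_extChartAt (by rwa [← extChartAt_source I]))
        (mdifferentiableWithinAt_extChartAt_symm hzt)
    · exact fun w _ ↦ mem_range_self _
    · exact I.uniqueDiffOn.uniqueMDiffOn _ hzr
  rw [mfderivWithin_eq_fderivWithin] at h3
  have hT : ∀ q q' : M, q = q' → ∀ u v : EuclideanSpace ℝ (Fin n), T q u v = T q' u v := by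
    rintro q _ rfl u v
    rfl
  ext u v
  rw [coordTensor, h3]
  exact hT _ _ hleft.symm _ _

end Charts

/-! ### The Laplacian in charts -/

section Laplacian

variable {n : ℕ} {Hs : Type*} [TopologicalSpace Hs]
  {I : ModelWithCorners ℝ (EuclideanSpace ℝ (Fin n)) Hs}
  {M : Type*} [TopologicalSpace M] [ChartedSpace Hs M] [IsManifold I ∞ M]

theorem extChartAt_mem_closure_interior_range (I : ModelWithCorners ℝ (EuclideanSpace ℝ (Fin n)) Hs)
    (c p : M) : extChartAt I c p ∈ closure (interior (range I)) :=
  I.range_subset_closure_interior (mem_range_self _)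

/-- The chart at `p` has differential `id` at `p`, so that the components of a tensor at `p` are the
values of the tensor. -/
theorem coordTensor_self (T : TensorField I M) (p : M) :
    coordTensor T p (extChartAt I p p) = T p := by
  have h1 := mfderivWithin_range_extChartAt_symm (𝕜 := ℝ) (I := I) (x := p)
  have h2 : ∀ q, q = p → ∀ u v : EuclideanSpace ℝ (Fin n), T q u v = T p u v := by
    rintro q rfl u v
    rfl
  ext u v
  rw [coordTensor, h1]
  exact h2 _ (extChartAt_to_inv p) u v

theorem hessian_eq (g : TensorField I M) (f : M → ℝ) (p : M) :
    hessian g f p = hessianCoord (coordTensor g p) (f ∘ (extChartAt I p).symm) (range I)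
      (extChartAt I p p) := by
  have h1 : chartDifferential I p = ContinuousLinearMap.id ℝ (TangentSpace I p) :=
    mfderiv_extChartAt_self
  ext u v
  rw [hessian, h1]
  rfl

theorem divergence_eq (g T : TensorField I M) (p : M) (v : TangentSpace I p) :
    divergence g T p v = divergenceCoord (coordTensor g p) (coordTensor T p) (range I)
      (extChartAt I p p) v := by
  have h1 : chartDifferential I p = ContinuousLinearMap.id ℝ (TangentSpace I p) :=
    mfderiv_extChartAt_self
  rw [divergence, h1]
  rfl

theorem laplacian_eq_self {g : TensorField I M} (hpos : ∀ p v, v ≠ 0 → 0 < g p v v)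
    (f : M → ℝ) (p : M) :
    laplacian g f p = laplacianCoord (coordTensor g p) (f ∘ (extChartAt I p).symm) (range I)
      (extChartAt I p p) := by
  rw [laplacian, hessian_eq, laplacianCoord, coordTensor_self]
  have hi := coordTensor_isInvertible hpos (mem_extChartAt_target (I := I) p)
  rw [coordTensor_self] at hi
  exact tensorInner_self_right (E := EuclideanSpace ℝ (Fin n)) hi _

theorem traceField_symm {g : TensorField I M} (hpos : ∀ p v, v ≠ 0 → 0 < g p v v)
    (T : TensorField I M) {c : M} {y : EuclideanSpace ℝ (Fin n)}
    (hy : y ∈ (extChartAt I c).target) :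
    traceField g T ((extChartAt I c).symm y)
      = metricTrace (coordTensor g c y) (coordTensor T c y) := by
  have hi := coordTensor_isInvertible hpos
    (mem_extChartAt_target (I := I) ((extChartAt I c).symm y))
  rw [coordTensor_self] at hi
  let B : EuclideanSpace ℝ (Fin n) →L[ℝ] EuclideanSpace ℝ (Fin n) :=
    mfderivWithin 𝓘(ℝ, EuclideanSpace ℝ (Fin n)) I (extChartAt I c).symm (range I) y
  have hB : B.IsInvertible := isInvertible_mfderivWithin_extChartAt_symm hy
  exact (tensorInner_self_right (E := EuclideanSpace ℝ (Fin n)) hi _).trans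
    (metricTrace_pull hB hi _).symm

omit [IsManifold I ∞ M] in
theorem differential_eq {f : M → ℝ} {p : M} (hf : MDifferentiableAt I 𝓘(ℝ, ℝ) f p) :
    differential I f p = fderivWithin ℝ (f ∘ (extChartAt I p).symm) (range I) (extChartAt I p p) :=
  hf.mfderiv

/-- A function that is differentiable in a chart is differentiable. -/
theorem mdifferentiableAt_of_eqOn_target {f : M → ℝ} {p : M} {u : EuclideanSpace ℝ (Fin n) → ℝ}
    (hu : DifferentiableWithinAt ℝ u (range I) (extChartAt I p p))
    (hfu : ∀ z ∈ (extChartAt I p).target, f ((extChartAt I p).symm z) = u z) :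
    MDifferentiableAt I 𝓘(ℝ, ℝ) f p := by
  have h1 : MDifferentiableWithinAt I 𝓘(ℝ, ℝ) (u ∘ extChartAt I p) univ p :=
    hu.mdifferentiableWithinAt.comp p
      (mdifferentiableAt_extChartAt (mem_chart_source Hs p)).mdifferentiableWithinAt
      fun _ _ ↦ mem_range_self _
  refine (mdifferentiableWithinAt_univ.1 h1).congr_of_eventuallyEq ?_
  filter_upwards [extChartAt_source_mem_nhds (I := I) p] with q hq
  rw [Function.comp_apply, ← hfu _ ((extChartAt I p).map_source hq), (extChartAt I p).left_inv hq]

/-- The components of a function in a chart are smooth. -/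
theorem contDiffWithinAt_comp_extChartAt_symm {k : ℕ∞ω} {f : M → ℝ} {c p : M}
    (hk : k ≤ ∞) (hf : ContMDiffAt I 𝓘(ℝ, ℝ) k f p) (hp : p ∈ (chartAt Hs c).source) :
    ContDiffWithinAt ℝ k (f ∘ (extChartAt I c).symm) (range I) (extChartAt I c p) := by
  have hpc : p ∈ (extChartAt I c).source := by rwa [extChartAt_source]
  have : IsManifold I k M := .of_le hk
  exact (ContMDiffAt.comp_contMDiffWithinAt_of_eq hf
    (contMDiffWithinAt_extChartAt_symm_range c ((extChartAt I c).map_source hpc))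
    ((extChartAt I c).left_inv hpc)).contDiffWithinAt

/-- The Laplacian may be computed in any chart. -/
theorem laplacian_eq_laplacianCoord {k : ℕ∞ω} (hk : 1 ≤ k) (g : Metric I k M) {f : M → ℝ}
    (hf : ContMDiff I 𝓘(ℝ, ℝ) ∞ f) {c p : M} (hp : p ∈ (chartAt Hs c).source) :
    laplacian g.inner f p = laplacianCoord (coordTensor g.inner c) (f ∘ (extChartAt I c).symm)
      (range I) (extChartAt I c p) := by
  have hpc : p ∈ (extChartAt I c).source := by rwa [extChartAt_source]
  set φ := extChartAt I c ∘ (extChartAt I p).symm with hφ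
  have hφp : φ (extChartAt I p p) = extChartAt I c p := by simp [hφ]
  have hys : extChartAt I p p ∈ range I := mem_range_self _
  have hs : UniqueDiffOn ℝ (range I) := I.uniqueDiffOn
  have hφd : ContDiffWithinAt ℝ 2 φ (range I) (extChartAt I p p) := by
    have : IsManifold I 2 M := .of_le (n := ∞) (by norm_cast)
    refine contDiffWithinAt_ext_coord_change c p ?_
    simpa [PartialEquiv.trans_source] using hp
  have hm : Tendsto φ (𝓝[range I] (extChartAt I p p)) (𝓝[range I] (φ (extChartAt I p p))) :=
    tendsto_nhdsWithin_iff.2 ⟨hφd.continuousWithinAt, Eventually.of_forall fun _ ↦ mem_range_self _⟩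
  have hG : DifferentiableWithinAt ℝ (coordTensor g.inner c) (range I) (extChartAt I c p) := by
    refine (contDiffWithinAt_slice_right (t := 0) (contDiffWithinAt_coordTensor (k := 1)
      (T := fun _ ↦ g.inner) (by norm_cast) ?_ hp)).differentiableWithinAt one_ne_zero
    exact ((g.contMDiff.of_le hk).comp contMDiff_snd).contMDiffAt
  have hi : (coordTensor g.inner c (extChartAt I c p)).IsInvertible :=
    coordTensor_isInvertible g.pos ((extChartAt I c).map_source hpc)
  have hA : (fderivWithin ℝ φ (range I) (extChartAt I p p)).IsInvertible := by
    have hGp := (coordTensor_eventuallyEq_pull g.inner hp).self_of_nhdsWithin hys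
    -- a vector in the kernel would have length zero for the metric in the chart at `p`
    have hinj : Function.Injective (fderivWithin ℝ φ (range I) (extChartAt I p p)).toLinearMap := by
      rw [← LinearMap.ker_eq_bot, LinearMap.ker_eq_bot']
      intro v hv
      by_contra hne
      have h1 := g.pos p v hne
      have h2 : coordTensor g.inner p (extChartAt I p p) v v = 0 := by
        have hv' : fderivWithin ℝ φ (range I) (extChartAt I p p) v = 0 := hv
        rw [hGp, pull_apply, hv', map_zero]
      rw [coordTensor_self] at h2
      exact h1.ne' h2
    exact ⟨(LinearEquiv.ofInjectiveEndo _ hinj).toContinuousLinearEquiv, by ext v; rfl⟩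
  have hF : ContDiffWithinAt ℝ 2 (f ∘ (extChartAt I c).symm) (range I) (extChartAt I c p) :=
    contDiffWithinAt_comp_extChartAt_symm (by norm_cast) (hf.contMDiffAt.of_le (by norm_cast)) hp
  have hFev : f ∘ (extChartAt I p).symm =ᶠ[𝓝[range I] (extChartAt I p p)]
      (f ∘ (extChartAt I c).symm) ∘ φ := by
    filter_upwards [eventually_extChartAt_symm_mem_source (I := I) hp] with z hz
    simp only [hφ, Function.comp_apply, (extChartAt I c).left_inv hz]
  rw [← hφp] at hG hi hF ⊢
  rw [laplacian_eq_self g.pos, laplacianCoord_congr hys (coordTensor_eventuallyEq_pull g.inner hp)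
    hFev]
  exact laplacianCoord_pull hs hys (extChartAt_mem_closure_interior_range I p p) hφd hm hG
    (coordTensor_symm g.symm c) hi hA (mem_range_self _) hF

variable {k : ℕ∞} {g : ℝ → Metric I k M}

theorem IsVariation.contDiffWithinAt_coordTensor (hk : 2 ≤ k) (hg : IsVariation g)
    {c p : M} (hp : p ∈ (chartAt Hs c).source) :
    ContDiffWithinAt ℝ 2 (Function.uncurry fun t ↦ coordTensor (g t).inner c) (univ ×ˢ range I)
      (0, extChartAt I c p) := by
  obtain ⟨ε, hε, hc⟩ := hg
  refine RiemVar.contDiffWithinAt_coordTensor (by norm_cast) ?_ hp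
  have h1 : Ioo (-ε) ε ×ˢ (univ : Set M) ∈ 𝓝 ((0 : ℝ), p) :=
    prod_mem_nhds (Ioo_mem_nhds (by linarith) hε) univ_mem
  exact (hc.contMDiffAt h1).of_le (WithTop.coe_le_coe.2 hk)

theorem IsVariation.hasDerivAt_inner (hk : 2 ≤ k) (hg : IsVariation g) (p : M) :
    HasDerivAt (F := EuclideanSpace ℝ (Fin n) →L[ℝ] EuclideanSpace ℝ (Fin n) →L[ℝ] ℝ)
      (fun t ↦ (g t).inner p) (variationTensor g p) 0 := by
  have h1 := (hasDerivAt_slice_left (mem_range_self _) ((hg.contDiffWithinAt_coordTensor hk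
    (mem_chart_source Hs p)).differentiableWithinAt two_ne_zero)).differentiableAt
  have h2 : (fun t ↦ coordTensor (g t).inner p (extChartAt I p p)) = fun t ↦ (g t).inner p :=
    funext fun t ↦ coordTensor_self _ p
  exact (h2 ▸ h1 : DifferentiableAt ℝ
    (F := EuclideanSpace ℝ (Fin n) →L[ℝ] EuclideanSpace ℝ (Fin n) →L[ℝ] ℝ)
      (fun t ↦ (g t).inner p) 0).hasDerivAt

/-- The components of `H` in a chart are the derivatives of the components of the metrics. -/
theorem coordTensor_variationTensor (hk : 2 ≤ k) (hg : IsVariation g) (c : M)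
    (y : EuclideanSpace ℝ (Fin n)) :
    coordTensor (variationTensor g) c y = deriv (fun t ↦ coordTensor (g t).inner c y) 0 := by
  have h1 := hg.hasDerivAt_inner hk ((extChartAt I c).symm y)
  set B : EuclideanSpace ℝ (Fin n) →L[ℝ] EuclideanSpace ℝ (Fin n) :=
    mfderivWithin 𝓘(ℝ, EuclideanSpace ℝ (Fin n)) I (extChartAt I c).symm (range I) y
  have h2 := (ContinuousLinearMap.compL ℝ (EuclideanSpace ℝ (Fin n))
    (EuclideanSpace ℝ (Fin n) →L[ℝ] ℝ) (EuclideanSpace ℝ (Fin n) →L[ℝ] ℝ)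
    (ContinuousLinearMap.precomp ℝ B)).hasFDerivAt.comp_hasDerivAt 0 (hasDerivAt_comp_const h1 B)
  exact h2.deriv.symm

theorem differentiableAt_laplacian (hk : 2 ≤ k) (hg : IsVariation g) {f : M → ℝ}
    (hf : ContMDiff I 𝓘(ℝ, ℝ) ∞ f) (p : M) :
    DifferentiableAt ℝ (fun t ↦ laplacian (g t).inner f p) 0 := by
  have h1 : (fun t ↦ laplacian (g t).inner f p) = fun t ↦ laplacianCoord (coordTensor (g t).inner p)
      (f ∘ (extChartAt I p).symm) (range I) (extChartAt I p p) :=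
    funext fun t ↦ laplacian_eq_self (g t).pos f p
  rw [h1]
  have hp := mem_chart_source Hs p
  exact (hasDerivAt_slice_left (mem_range_self _) ((contDiffWithinAt_laplacianCoord I.uniqueDiffOn
    (mem_range_self _) (hg.contDiffWithinAt_coordTensor hk hp)
    (coordTensor_isInvertible (g 0).pos (mem_extChartAt_target p))
    (contDiffWithinAt_comp_extChartAt_symm (k := 3) (by norm_cast)
      (hf.contMDiffAt.of_le (by norm_cast)) hp)).differentiableWithinAt
        one_ne_zero)).differentiableAt

/-- The variation of the Laplacian, at a point. -/
theorem laplacianVariation_eq (hk : 2 ≤ k) (hg : IsVariation g) {f : M → ℝ}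
    (hf : ContMDiff I 𝓘(ℝ, ℝ) ∞ f) (p : M) :
    laplacianVariation g f p =
      1 / 2 * covectorInner ((g 0).inner p)
          (differential I (traceField (g 0).inner (variationTensor g)) p) (differential I f p)
        - covectorInner ((g 0).inner p) (divergence (g 0).inner (variationTensor g) p)
          (differential I f p)
        - tensorInner ((g 0).inner p) (variationTensor g p) (hessian (g 0).inner f p) := by
  have h1 : (fun t ↦ laplacian (g t).inner f p) = fun t ↦ laplacianCoord (coordTensor (g t).inner p)
      (f ∘ (extChartAt I p).symm) (range I) (extChartAt I p p) :=
    funext fun t ↦ laplacian_eq_self (g t).pos f p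
  have hp := mem_chart_source Hs p
  have hys : extChartAt I p p ∈ range I := mem_range_self _
  have hF : ContDiffWithinAt ℝ 3 (f ∘ (extChartAt I p).symm) (range I) (extChartAt I p p) :=
    contDiffWithinAt_comp_extChartAt_symm (by norm_cast) (hf.contMDiffAt.of_le (by norm_cast)) hp
  have hi : (coordTensor (g 0).inner p (extChartAt I p p)).IsInvertible :=
    coordTensor_isInvertible (g 0).pos (mem_extChartAt_target p)
  have hderiv := hasDerivAt_laplacianCoord I.uniqueDiffOn hys
    (extChartAt_mem_closure_interior_range I p p) (hg.contDiffWithinAt_coordTensor hk hp)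
    (fun t ↦ coordTensor_symm (g t).symm p) hi hF
    (funext fun z ↦ coordTensor_variationTensor hk hg p z)
  have hdf := differential_eq ((hf p).mdifferentiableAt (by simp))
  have htr : ∀ z ∈ (extChartAt I p).target,
      traceField (g 0).inner (variationTensor g) ((extChartAt I p).symm z)
        = metricTrace (coordTensor (g 0).inner p z) (coordTensor (variationTensor g) p z) :=
    fun z hz ↦ traceField_symm (g 0).pos _ hz
  have hdh : differential I (traceField (g 0).inner (variationTensor g)) p
      = fderivWithin ℝ (fun z ↦ metricTrace (coordTensor (g 0).inner p z)
          (coordTensor (variationTensor g) p z)) (range I) (extChartAt I p p) := by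
    have hΦ := hg.contDiffWithinAt_coordTensor hk hp
    have hH : ContDiffWithinAt ℝ 1 (coordTensor (variationTensor g) p) (range I)
        (extChartAt I p p) := by
      rw [funext fun z ↦ coordTensor_variationTensor hk hg p z]
      exact contDiffWithinAt_deriv_param I.uniqueDiffOn hys (by norm_num) hΦ
    have hu : DifferentiableWithinAt ℝ (fun z ↦ metricTrace (coordTensor (g 0).inner p z)
        (coordTensor (variationTensor g) p z)) (range I) (extChartAt I p p) :=
      (contDiffWithinAt_metricTrace ((contDiffWithinAt_slice_right hΦ).of_le one_le_two) hH
        hi).differentiableWithinAt one_ne_zero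
    rw [differential_eq (mdifferentiableAt_of_eqOn_target hu htr)]
    refine Filter.EventuallyEq.fderivWithin_eq ?_ (htr _ (mem_extChartAt_target p))
    filter_upwards [extChartAt_target_mem_nhdsWithin p] with z hz using htr z hz
  rw [laplacianVariation, h1, hderiv.deriv, hdf, hdh, hessian_eq]
  have hgs := coordTensor_symm (g 0).symm p (extChartAt I p p)
  have hK := hessianCoord_symm (coordTensor_symm (g 0).symm p) I.uniqueDiffOn hys
    (extChartAt_mem_closure_interior_range I p p) (hF.of_le (by norm_num))
  have hin := tensorInner_of_symm hi hgs (coordTensor (variationTensor g) p (extChartAt I p p)) hK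
  rw [coordTensor_self, coordTensor_self] at hin
  simp only [covectorInner, divergence_eq]
  rw [coordTensor_self, coordTensor_self]
  refine congrArg₂ _ rfl hin.symm

/-- `Δ'f` is continuous. In its definition the chart depends on the point, so near a point `c` it is
first rewritten in the fixed chart at `c`, by the invariance of the Laplacian. -/
theorem continuous_laplacianVariation (hk : 2 ≤ k) (hg : IsVariation g) {f : M → ℝ}
    (hf : ContMDiff I 𝓘(ℝ, ℝ) ∞ f) : Continuous (laplacianVariation g f) := by
  have hk1 : (1 : ℕ∞ω) ≤ k := by exact_mod_cast le_trans one_le_two hk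
  rw [continuous_iff_continuousAt]
  intro c
  have hc := mem_chart_source Hs c
  have h1 : laplacianVariation g f =ᶠ[𝓝 c] (fun z ↦ deriv (fun t ↦ laplacianCoord
      (coordTensor (g t).inner c) (f ∘ (extChartAt I c).symm) (range I) z) 0) ∘ extChartAt I c := by
    filter_upwards [(chartAt Hs c).open_source.mem_nhds hc] with p hp
    simp only [laplacianVariation, Function.comp_apply, laplacian_eq_laplacianCoord hk1 (g _) hf hp]
  refine ContinuousAt.congr ?_ h1.symm
  have h2 := continuousWithinAt_deriv_laplacianCoord I.uniqueDiffOn (mem_range_self _)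
    (hg.contDiffWithinAt_coordTensor hk hc)
    (coordTensor_isInvertible (g 0).pos (mem_extChartAt_target c))
    (contDiffWithinAt_comp_extChartAt_symm (k := 3) (by norm_cast)
      (hf.contMDiffAt.of_le (by norm_cast)) hc)
  exact Tendsto.comp h2 (tendsto_nhdsWithin_iff.2
    ⟨continuousAt_extChartAt c, Eventually.of_forall fun _ ↦ mem_range_self _⟩)

end Laplacian

/-! ### Finiteness of the volume -/

section Volume

variable {n : ℕ} {Hs : Type*} [TopologicalSpace Hs]
  {I : ModelWithCorners ℝ (EuclideanSpace ℝ (Fin n)) Hs}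
  {M : Type*} [TopologicalSpace M] [ChartedSpace Hs M]

theorem measurableSet_extChartAt_target (c : M) : MeasurableSet (extChartAt I c).target := by
  rw [extChartAt_target]
  exact ((chartAt Hs c).open_target.preimage I.continuous_symm).measurableSet.inter
    I.isClosed_range.measurableSet

variable [IsManifold I ∞ M]

theorem continuousOn_coordTensor {k : ℕ∞ω} (g : Metric I k M) (c : M) :
    ContinuousOn (coordTensor g.inner c) (extChartAt I c).target := by
  intro y hy
  have hp : (extChartAt I c).symm y ∈ (chartAt Hs c).source := by
    rw [← extChartAt_source I]
    exact (extChartAt I c).map_target hy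
  have h1 := contDiffWithinAt_slice_right (t := 0) (contDiffWithinAt_coordTensor (k := 0)
    (T := fun _ ↦ g.inner) (by norm_cast)
    (((g.contMDiff.of_le zero_le).comp contMDiff_snd).contMDiffAt) hp)
  rw [(extChartAt I c).right_inv hy] at h1
  exact h1.continuousWithinAt.mono (extChartAt_target_subset_range c)

/-- The Riemannian volume of a compact set in a chart domain is finite. -/
theorem chartVolume_lt_top [MeasurableSpace M] [BorelSpace M] [T2Space M] {k : ℕ∞ω}
    (g : Metric I k M) {c : M} {K : Set M} (hK : IsCompact K) (hKs : K ⊆ (chartAt Hs c).source) :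
    chartVolume g.inner c K < ⊤ := by
  rw [← extChartAt_source I] at hKs
  -- for a map that is not measurable, `Measure.map` would be zero
  have hmeas : AEMeasurable (extChartAt I c).symm (volume.restrict (extChartAt I c).target) :=
    (continuousOn_extChartAt_symm c).aemeasurable (measurableSet_extChartAt_target c)
  have hpre : (extChartAt I c).symm ⁻¹' K ∩ (extChartAt I c).target = extChartAt I c '' K := by
    rw [(extChartAt I c).image_eq_target_inter_inv_preimage hKs, inter_comm]
  have hcomp : IsCompact (extChartAt I c '' K) :=
    hK.image_of_continuousOn ((continuousOn_extChartAt c).mono hKs)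
  have hsub : extChartAt I c '' K ⊆ (extChartAt I c).target := hpre ▸ inter_subset_right
  have hdet : Continuous fun T : EuclideanSpace ℝ (Fin n) →L[ℝ] EuclideanSpace ℝ (Fin n) →L[ℝ] ℝ ↦
      Real.sqrt (Matrix.of fun i j : Fin n ↦ T (EuclideanSpace.single i 1)
        (EuclideanSpace.single j 1)).det := by
    refine Real.continuous_sqrt.comp (Continuous.matrix_det ?_)
    refine continuous_matrix fun i j ↦ ?_
    simp only [Matrix.of_apply]
    fun_prop
  obtain ⟨C, hC⟩ := hcomp.exists_bound_of_continuousOn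
    (hdet.comp_continuousOn ((continuousOn_coordTensor g c).mono hsub))
  rw [chartVolume, Measure.map_apply_of_aemeasurable
    (hmeas.mono_ac (withDensity_absolutelyContinuous _ _)) hK.measurableSet, withDensity_apply',
    Measure.restrict_restrict' (measurableSet_extChartAt_target c), hpre]
  calc _ ≤ ∫⁻ _ in extChartAt I c '' K, ENNReal.ofReal C := by
        refine setLIntegral_mono' hcomp.measurableSet fun y hy ↦ ENNReal.ofReal_le_ofReal ?_
        exact (le_abs_self _).trans (hC y hy)
    _ < ⊤ := by
        rw [setLIntegral_const]
        exact ENNReal.mul_lt_top ENNReal.ofReal_lt_top hcomp.measure_lt_top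

/-- The volume of a compact Riemannian manifold is finite. -/
instance isFiniteMeasure_volumeMeasure [T2Space M] [CompactSpace M] [MeasurableSpace M]
    [BorelSpace M] {k : ℕ∞ω} (g : Metric I k M) : IsFiniteMeasure (volumeMeasure g.inner) := by
  -- only finitely many functions of the partition are nonzero, each with compact support in a chart
  set ρ := chartPartition I M
  have hsub : ρ.IsSubordinate fun c ↦ (chartAt Hs c).source :=
    (SmoothPartitionOfUnity.exists_isSubordinate_chartAt_source I M).choose_spec
  have hfin : {c | (Function.support (ρ c)).Nonempty}.Finite :=
    ρ.locallyFinite.finite_nonempty_of_compact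
  have hzero : ∀ c ∉ hfin.toFinset, ((chartVolume g.inner c).withDensity fun p ↦
      ENNReal.ofReal (ρ c p)) univ = 0 := by
    intro c hc
    have h0 : ∀ p, ρ c p = 0 := by
      simpa [Function.support, Set.Nonempty] using hc
    simp [h0]
  refine ⟨?_⟩
  rw [volumeMeasure, Measure.sum_apply _ MeasurableSet.univ, tsum_eq_sum hzero]
  refine ENNReal.sum_lt_top.2 fun c _ ↦ ?_
  rw [withDensity_apply _ MeasurableSet.univ, Measure.restrict_univ]
  calc ∫⁻ p, ENNReal.ofReal (ρ c p) ∂(chartVolume g.inner c)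
      ≤ ∫⁻ p, (tsupport (ρ c)).indicator 1 p ∂(chartVolume g.inner c) := by
        refine lintegral_mono fun p ↦ ?_
        by_cases hp : p ∈ tsupport (ρ c)
        · simpa [hp] using ρ.le_one c p
        · simp [hp, image_eq_zero_of_notMem_tsupport hp]
    _ = chartVolume g.inner c (tsupport (ρ c)) :=
        lintegral_indicator_one (isClosed_tsupport _).measurableSet
    _ < ⊤ := chartVolume_lt_top g (isClosed_tsupport _).isCompact (hsub c)

end Volume

end RiemVar

theorem proposition2 {n : ℕ} {Hs : Type*} [TopologicalSpace Hs]
    (I : ModelWithCorners ℝ (EuclideanSpace ℝ (Fin n)) Hs)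
    {M : Type*} [TopologicalSpace M] [ChartedSpace Hs M] [IsManifold I ∞ M]
    [T2Space M] [CompactSpace M] [MeasurableSpace M] [BorelSpace M]
    (k : ℕ∞) (hk : 2 ≤ k) (g : ℝ → RiemVar.Metric I k M) (hg : RiemVar.IsVariation g)
    (g₀ H : RiemVar.TensorField I M) (hg₀ : g₀ = (g 0).inner) (hH : H = RiemVar.variationTensor g)
    (h : M → ℝ) (hh : h = RiemVar.traceField g₀ H)
    (f l : M → ℝ) (hf : ContMDiff I 𝓘(ℝ, ℝ) ∞ f) (hl : ContMDiff I 𝓘(ℝ, ℝ) ∞ l) :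
    (∀ p, DifferentiableAt ℝ (fun t ↦ RiemVar.laplacian (g t).inner f p) 0) ∧
    Integrable (fun p ↦ l p * RiemVar.laplacianVariation g f p) (RiemVar.volumeMeasure g₀) ∧
    Integrable (fun p ↦ l p *
      (1 / 2 * RiemVar.covectorInner (g₀ p) (RiemVar.differential I h p)
          (RiemVar.differential I f p)
        - RiemVar.covectorInner (g₀ p) (RiemVar.divergence g₀ H p) (RiemVar.differential I f p)
        - RiemVar.tensorInner (g₀ p) (H p) (RiemVar.hessian g₀ f p)))
      (RiemVar.volumeMeasure g₀) ∧
    ∫ p, l p * RiemVar.laplacianVariation g f p ∂(RiemVar.volumeMeasure g₀) =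
      ∫ p, l p *
        (1 / 2 * RiemVar.covectorInner (g₀ p) (RiemVar.differential I h p)
            (RiemVar.differential I f p)
          - RiemVar.covectorInner (g₀ p) (RiemVar.divergence g₀ H p) (RiemVar.differential I f p)
          - RiemVar.tensorInner (g₀ p) (H p) (RiemVar.hessian g₀ f p))
        ∂(RiemVar.volumeMeasure g₀) := by
  subst hg₀ hH hh
  -- the integrands agree pointwise
  have heq := RiemVar.laplacianVariation_eq hk hg hf
  have hint : Integrable (fun p ↦ l p * RiemVar.laplacianVariation g f p)
      (RiemVar.volumeMeasure (g 0).inner) := by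
    have hc : Continuous fun p ↦ l p * RiemVar.laplacianVariation g f p :=
      hl.continuous.mul (RiemVar.continuous_laplacianVariation hk hg hf)
    exact hc.integrable_of_hasCompactSupport (HasCompactSupport.of_compactSpace _)
  refine ⟨RiemVar.differentiableAt_laplacian hk hg hf, hint, ?_, ?_⟩
  · simpa only [heq] using hint
  · simp only [heq]
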